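/- Let $\mathfrak g$ be a finite-dimensional real nilpotent Lie algebra with Baker–Campbell–Hausdorff product $X\bullet Y=\log(\exp X\exp Y)=X+Y+\tfrac12[X,Y]+\cdots$ (so that $(\mathfrak g,\bullet)$ is the connected, simply connected nilpotent Lie group with Lie algebra $\mathfrak g$, written in exponential coordinates). Let $\mathfrak g^\sharp$ be its dual, $\langle X\mid\xi\rangle=\xi(X)$, and $\Xi=\mathfrak g\times\mathfrak g^\sharp$. Let $dX$ be a Haar measure on $\mathfrak g$ and $d\xi$ the Haar measure on $\mathfrak g^\sharp$ for which $\mathfrak u\mapsto\int e^{i\langle X\mid\xi\rangle}\mathfrak u(\xi)\,d\xi$ inverts $u\mapsto\int e^{-i\langle X\mid\xi\rangle}u(X)\,dX$ on Schwartz functions; $\Xi$ carries the product measure. Scalar products are linear in the first variable. For a symbol $F$ on $\Xi$ let ${\sf Op}(F)$ be the operator on $L^2(\mathfrak g)$ given on Schwartz functions $u$ by $$[{\sf Op}(F)u](X)=\int_{\mathfrak g^\sharp}\int_{\mathfrak g}e^{i\langle X\bullet(-Y)\mid\xi\rangle}F(X,\xi)\,u(Y)\,dY\,d\xi ,$$ which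 is bounded for $F\in L^2(\Xi)$ and for the functions $\varepsilon_{(Z,\zeta)}(X,\xi)=e^{i\langle X\mid\zeta\rangle}e^{-i\langle Z\mid\xi\rangle}$. For $f,g\in L^2(\Xi)$ let $f\# g\in L^2(\Xi)$ be the symbol of ${\sf Op}(f){\sf Op}(g)$, let $f^\#\in L^2(\Xi)$ be the symbol of ${\sf Op}(f)^*$, and for $\mathcal Y,\mathcal Z\in\Xi$ let $\theta_{\mathcal Y,\mathcal Z}(f)=\varepsilon_{\mathcal Y}\# f\#\varepsilon_{\mathcal Z}^\#\in L^2(\Xi)$ be the symbol of ${\sf Op}(\varepsilon_{\mathcal Y})\,{\sf Op}(f)\,{\sf Op}(\varepsilon_{\mathcal Z})^*$. For a window $h$ and $f\in L^2(\Xi)$ set $$[\mathfrak E_h(f)](\mathcal Y,\mathcal Z)=\langle\theta_{\mathcal Y,\mathcal Z}(f),h\rangle_{L^2(\Xi)} ,$$ and for kernels $K,L$ on $\Xi\times\Xi$ set $$(K\circ L)(\mathcal Y,\mathcal Z)=\int_\Xi K(\mathcal Y,\mathcal X)L(\mathcal X,\mathcal Z)\,d\mathcal X,\qquad K^\circ(\mathcal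 Y,\mathcal Z)=\overline{K(\mathcal Z,\mathcal Y)} .$$ **Proposition.** For all $h,k\in\mathcal S(\Xi)$ and $f,g\in L^2(\Xi)$, the integral defining $\big(\mathfrak E_h(f)\circ\mathfrak E_k(g)\big)(\mathcal Y,\mathcal Z)$ converges absolutely for all $\mathcal Y,\mathcal Z\in\Xi$, and $$\mathfrak E_{h\#k}(f\#g)=\mathfrak E_h(f)\circ\mathfrak E_k(g),\qquad \mathfrak E_{h^\#}\big(f^\#\big)=\mathfrak E_h(f)^\circ .$$ -/

import Mathlib

open MeasureTheory
open scoped SchwartzMap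

noncomputable section

/-- A real Lie algebra structure on the vector space underlying a real normed space. The norm only
provides the topology (all norms are equivalent in finite dimension); no compatibility between the
norm and the bracket is required. -/
class RealLieStructure (𝔤 : Type*) [NormedAddCommGroup 𝔤] [NormedSpace ℝ 𝔤] extends
    Bracket 𝔤 𝔤 where
  add_lie : ∀ x y z : 𝔤, ⁅x + y, z⁆ = ⁅x, z⁆ + ⁅y, z⁆
  lie_add : ∀ x y z : 𝔤, ⁅x, y + z⁆ = ⁅x, y⁆ + ⁅x, z⁆
  lie_self : ∀ x : 𝔤, ⁅x, x⁆ = 0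
  leibniz_lie : ∀ x y z : 𝔤, ⁅x, ⁅y, z⁆⁆ = ⁅⁅x, y⁆, z⁆ + ⁅y, ⁅x, z⁆⁆
  lie_smul : ∀ (t : ℝ) (x y : 𝔤), ⁅x, t • y⁆ = t • ⁅x, y⁆

instance RealLieStructure.instLieRing {𝔤 : Type*} [NormedAddCommGroup 𝔤] [NormedSpace ℝ 𝔤]
    [RealLieStructure 𝔤] : LieRing 𝔤 where
  add_lie := RealLieStructure.add_lie
  lie_add := RealLieStructure.lie_add
  lie_self := RealLieStructure.lie_self
  leibniz_lie := RealLieStructure.leibniz_lie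

instance RealLieStructure.instLieAlgebra {𝔤 : Type*} [NormedAddCommGroup 𝔤] [NormedSpace ℝ 𝔤]
    [RealLieStructure 𝔤] : LieAlgebra ℝ 𝔤 where
  lie_smul := RealLieStructure.lie_smul

namespace NilpotentWeyl

/-! ### The group law `X • Y` on a nilpotent Lie algebra -/

section GroupLaw

variable {𝔤 : Type*} [LieRing 𝔤] [LieAlgebra ℝ 𝔤]

/-- The right-normed iterated bracket `[x₁, [x₂, … [x_{m-1}, x_m] …]]` of a list. -/
def nestedLie : List 𝔤 → 𝔤
  | [] => 0
  | [x] => x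
  | x :: y :: l => ⁅x, nestedLie (y :: l)⁆

/-- The summand of Dynkin's form of the Baker-Campbell-Hausdorff series that belongs to the
exponents `p = ((r₁, s₁), …, (rₙ, sₙ))`:
`(-1)ⁿ⁻¹ / n * (∑ᵢ (rᵢ + sᵢ))⁻¹ * ∏ᵢ (rᵢ! sᵢ!)⁻¹` times the right-normed bracket of the word
`X^{r₁} Y^{s₁} ⋯ X^{rₙ} Y^{sₙ}`. -/
def dynkinTerm (X Y : 𝔤) (n : ℕ) (p : Fin n → ℕ × ℕ) : 𝔤 :=
  ((-1 : ℝ) ^ (n - 1) / (n : ℝ) * ((∑ i, ((p i).1 + (p i).2) : ℕ) : ℝ)⁻¹ *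
      ∏ i, (((p i).1.factorial : ℝ) * ((p i).2.factorial : ℝ))⁻¹) •
    nestedLie (List.ofFn fun i =>
      List.replicate (p i).1 X ++ List.replicate (p i).2 Y).flatten

/-- The exponents `((r₁, s₁), …, (rₙ, sₙ))` with all `rᵢ + sᵢ > 0` and total degree `N`. -/
def dynkinIndex (N n : ℕ) : Finset (Fin n → ℕ × ℕ) :=
  (Fintype.piFinset fun _ : Fin n => Finset.range (N + 1) ×ˢ Finset.range (N + 1)).filter
    fun p => (∀ i, 0 < (p i).1 + (p i).2) ∧ ∑ i, ((p i).1 + (p i).2) = N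

/-- The Baker-Campbell-Hausdorff product
`X • Y = log (exp X exp Y) = X + Y + ½[X,Y] + 1/12 [X,[X,Y]] + 1/12 [Y,[Y,X]] + ⋯`
on a nilpotent Lie algebra. Iterated brackets with more than `nilpotencyLength` entries vanish, so
the series is summed over total degrees `N` up to that length. -/
def bch (X Y : 𝔤) : 𝔤 :=
  ∑ N ∈ Finset.Icc 1 (LieModule.nilpotencyLength 𝔤 𝔤), ∑ n ∈ Finset.Icc 1 N,
    ∑ p ∈ dynkinIndex N n, dynkinTerm X Y n p

end GroupLaw

/-! ### Phase space, pseudo-differential calculus, coorbit map -/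

variable {𝔤 : Type*} [NormedAddCommGroup 𝔤] [NormedSpace ℝ 𝔤] [FiniteDimensional ℝ 𝔤]
  [MeasurableSpace 𝔤] [BorelSpace 𝔤]

/-- The phase space `Ξ = 𝔤 × 𝔤♯`, where `𝔤♯` is the dual of `𝔤`; the pairing is
`⟨X | ξ⟩ = ξ X`. -/
abbrev Phase (𝔤 : Type*) [NormedAddCommGroup 𝔤] [NormedSpace ℝ 𝔤] : Type _ :=
  𝔤 × StrongDual ℝ 𝔤

/-- The measure `ν` on `𝔤♯` is normalized so that
`(𝓕⁻¹ 𝔲)(X) = ∫ e^{i⟨X|ξ⟩} 𝔲(ξ) dν(ξ)` inverts `(𝓕 u)(ξ) = ∫ e^{-i⟨X|ξ⟩} u(X) dμ(X)` on Schwartz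
functions. For a Haar measure `μ` there is exactly one such Haar measure `ν`. -/
def IsDualHaar (μ : Measure 𝔤) (ν : Measure (StrongDual ℝ 𝔤)) : Prop :=
  ∀ (u : 𝓢(𝔤, ℂ)) (X : 𝔤),
    ∫ ξ, Complex.exp (Complex.I * (ξ X : ℂ)) *
      (∫ Y, Complex.exp (-(Complex.I * (ξ Y : ℂ))) * u Y ∂μ) ∂ν = u X

/-- `ε_{(Z,ζ)}(X,ξ) = e^{i⟨X|ζ⟩} e^{-i⟨Z|ξ⟩}`. -/
def eps (𝒵 : Phase 𝔤) : Phase 𝔤 → ℂ := fun 𝒳 =>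
  Complex.exp (Complex.I * (𝒵.2 𝒳.1 : ℂ)) * Complex.exp (-(Complex.I * (𝒳.2 𝒵.1 : ℂ)))

variable [RealLieStructure 𝔤]

/-- The right-hand side of
`[Op(F)u](X) = ∫ ∫ e^{i⟨X • (-Y) | ξ⟩} F(X,ξ) u(Y) dY dξ`.
For Schwartz `u` the inner integral is rapidly decreasing in `ξ`, so both integrals converge
absolutely if `F` is bounded, and for almost every `X` if `F` is square integrable. -/
def opIntegral (μ : Measure 𝔤) (ν : Measure (StrongDual ℝ 𝔤)) (F : Phase 𝔤 → ℂ) (u : 𝔤 → ℂ)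
    (X : 𝔤) : ℂ :=
  ∫ ξ, F (X, ξ) * (∫ Y, Complex.exp (Complex.I * (ξ (bch X (-Y)) : ℂ)) * u Y ∂μ) ∂ν

section Calculus

variable (μ : Measure 𝔤) [μ.IsAddHaarMeasure]
  (ν : Measure (StrongDual ℝ 𝔤)) [ν.IsAddHaarMeasure]

/-- The bounded operator `T` on `L²(𝔤)` is the pseudo-differential operator with symbol `F`: it is
given by the quantization formula on Schwartz functions, which are dense. -/
def IsOp (F : Phase 𝔤 → ℂ) (T : Lp ℂ 2 μ →L[ℂ] Lp ℂ 2 μ) : Prop :=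
  ∀ u : 𝓢(𝔤, ℂ), (T (u.toLp 2 μ) : 𝔤 → ℂ) =ᵐ[μ] opIntegral μ ν F u

open Classical in
/-- The quantization `Op(F)` of a symbol whose pseudo-differential operator is bounded on `L²(𝔤)`
(such are the square integrable symbols and the functions `ε_𝒵`); `0` for other symbols. -/
def Op (F : Phase 𝔤 → ℂ) : Lp ℂ 2 μ →L[ℂ] Lp ℂ 2 μ :=
  if h : ∃ T, IsOp μ ν F T then h.choose else 0

/-- The square integrable symbol of an operator (of Hilbert-Schmidt class): the inverse of
`Op : L²(Ξ) → B(L²(𝔤))` on its range. -/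
def symb : (Lp ℂ 2 μ →L[ℂ] Lp ℂ 2 μ) → Lp ℂ 2 (μ.prod ν) :=
  Function.invFun fun f : Lp ℂ 2 (μ.prod ν) => Op μ ν f

/-- `f # g`, the symbol of the product `Op(f) Op(g)`. -/
def moyal (f g : Lp ℂ 2 (μ.prod ν)) : Lp ℂ 2 (μ.prod ν) :=
  symb μ ν (Op μ ν f ∘L Op μ ν g)

/-- `f^#`, the symbol of the adjoint `Op(f)*`. -/
def moyalAdj (f : Lp ℂ 2 (μ.prod ν)) : Lp ℂ 2 (μ.prod ν) :=
  symb μ ν (ContinuousLinearMap.adjoint (Op μ ν f))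

/-- The phase-space shift `θ_{𝒴,𝒵}(f) = ε_𝒴 # f # ε_𝒵^#`, that is, the square integrable symbol of
`Op(ε_𝒴) Op(f) Op(ε_𝒵)*` (product and involution of symbols with bounded quantization are those
transported by `Op` from the bounded operators). -/
def theta (𝒴 𝒵 : Phase 𝔤) (f : Lp ℂ 2 (μ.prod ν)) : Lp ℂ 2 (μ.prod ν) :=
  symb μ ν (Op μ ν (eps 𝒴) ∘L Op μ ν f ∘L ContinuousLinearMap.adjoint (Op μ ν (eps 𝒵)))

/-- `[𝔈_h(f)](𝒴,𝒵) = ⟨θ_{𝒴,𝒵}(f), h⟩`, with the scalar product of `L²(Ξ)` that is linear in its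
first entry (`inner ℂ` is linear in the second one). -/
def coorbitMap (h f : Lp ℂ 2 (μ.prod ν)) (𝒴 𝒵 : Phase 𝔤) : ℂ :=
  inner ℂ h (theta μ ν 𝒴 𝒵 f)

/-- `(K ∘ L)(𝒴,𝒵) = ∫ K(𝒴,𝒳) L(𝒳,𝒵) d𝒳`. -/
def kerComp (K L : Phase 𝔤 → Phase 𝔤 → ℂ) (𝒴 𝒵 : Phase 𝔤) : ℂ :=
  ∫ 𝒳, K 𝒴 𝒳 * L 𝒳 𝒵 ∂(μ.prod ν)

end Calculus

/-- `K^∘(𝒴,𝒵)` is the complex conjugate of `K(𝒵,𝒴)`. -/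
def kerAdj (K : Phase 𝔤 → Phase 𝔤 → ℂ) (𝒴 𝒵 : Phase 𝔤) : ℂ :=
  starRingEnd ℂ (K 𝒵 𝒴)

end NilpotentWeyl

end

set_option linter.unusedSectionVars false

noncomputable section

/-! ### Plancherel's theorem for the pairing between `𝔤` and its dual -/

namespace NilpotentWeyl

open FourierTransform Complex

/-! Everything is transported to Hilbert-Schmidt operators. The inverse partial Fourier transform in
`ξ`, followed by the substitution `W = X • (-Y)`, turns `f ∈ L²(Ξ)` into the integral kernel of
`Op(f)` (`kerOf`, `isOp_of_hasKer`). This is unitary onto `L²(𝔤 × 𝔤)`, because `ν` is normalized for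
Plancherel and the substitution preserves Haar measure. Hence `#` on symbols is composition of
kernels and `f^#` is the adjoint kernel. The operator `Op(ε_(Z,ζ))` is `u ↦ e^{i⟨X|ζ⟩} u(Y)` with `X
• (-Y) = Z` (`isOp_eps`), and `𝔈_h(f)(𝒴,𝒵) = Tr(Op(ε_𝒴) Op(f) Op(ε_𝒵)* Op(h)*)`. The involution rule
expresses that adjoints conjugate Hilbert-Schmidt scalar products.

The product rule rests on an orthogonality relation. For Hilbert-Schmidt `A` and `H`, the function
`𝒵 ↦ ⟨A Op(ε_𝒵)*, H⟩` is, at every point, the partial Fourier transform of the kernel of `H*A` in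
measure-preserving coordinates (`pft_correlation`). So it lies in `L²(Ξ)`, and two such functions
pair to `⟨H₁*A₁, H₂*A₂⟩`. Take `A₁ = Op(ε_𝒴)Op(f)`, `H₁ = Op(h)`, `A₂ = Op(ε_𝒵)Op(g)*`, `H₂ =
Op(k)*`. The composition integral converges by Cauchy-Schwarz and equals `⟨Op(h)*Op(ε_𝒴)Op(f),
Op(k)Op(ε_𝒵)Op(g)*⟩`, which is `⟨Op(ε_𝒴)Op(f)Op(g)Op(ε_𝒵)*, Op(h)Op(k)⟩` by cyclicity of the trace
(`integral_conj_kcomp_kcomp`).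

What is needed about `•` does not come from the group axioms. The part of degree at least two gains
one step in the lower central series (`contracting₂_bchRem`), so the relevant maps are, up to sign,
triangular perturbations of the identity: bijective, with Jacobian 1 and temperate growth. -/

/-- On `L¹ ∩ L²` the Fourier transform of `L²` is given by the Fourier integral. -/
theorem fourier_toLp_ae_eq {E : Type*} [NormedAddCommGroup E] [InnerProductSpace ℝ E]
    [FiniteDimensional ℝ E] [MeasurableSpace E] [BorelSpace E] {f : E → ℂ}
    (h1 : Integrable f) (h2 : MemLp f 2) :
    (𝓕 (h2.toLp f) : Lp ℂ 2 (volume : Measure E)) =ᵐ[volume] 𝓕 f := by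
  have hc : Continuous (𝓕 f) :=
    VectorFourier.fourierIntegral_continuous Real.continuous_fourierChar
      (by exact continuous_inner) h1
  refine ae_eq_of_integral_contDiff_smul_eq ((Lp.memLp _).locallyIntegrable (by norm_num))
    hc.locallyIntegrable fun g hg hgs => ?_
  have hG1 : HasCompactSupport fun x => (g x : ℂ) := hgs.comp_left (g := fun t : ℝ => (t : ℂ)) rfl
  have hG2 : ContDiff ℝ ((⊤ : ℕ∞) : WithTop ℕ∞) fun x => (g x : ℂ) :=
    Complex.ofRealCLM.contDiff.comp hg
  set G : 𝓢(E, ℂ) := hG1.toSchwartzMap hG2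
  have hGc : ∀ x, G x = g x := fun x => rfl
  have e1 : ∀ F : E → ℂ, ∫ x, g x • F x = ∫ x, G x • F x := fun F => by
    simp only [hGc, Complex.real_smul, smul_eq_mul]
  have key := congrArg (fun T => T G) (Lp.fourier_toTemperedDistribution_eq (h2.toLp f))
  -- The `L²` transform is compatible with that of tempered distributions, so testing against `G`
  -- moves the transform onto `G`; for the integral transform of `f ∈ L¹` Fubini does the same.
  simp only [TemperedDistribution.fourier_apply, Lp.toTemperedDistribution_apply] at key
  rw [e1, e1, ← key]
  have : ∫ x, (𝓕 G) x • (h2.toLp f) x = ∫ x, (𝓕 G) x • f x := by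
    refine integral_congr_ae ?_
    filter_upwards [h2.coeFn_toLp] with x hx
    rw [hx]
  rw [this]
  have := VectorFourier.integral_fourierIntegral_smul_eq_flip (L := innerₗ E)
    (μ := volume) (ν := volume) (f := G) (g := f)
    Real.continuous_fourierChar continuous_inner G.integrable h1
  rw [flip_innerₗ] at this
  exact this

theorem plancherel_euclidean {E : Type*} [NormedAddCommGroup E] [InnerProductSpace ℝ E]
    [FiniteDimensional ℝ E] [MeasurableSpace E] [BorelSpace E] {f g : E → ℂ}
    (hf1 : Integrable f) (hf2 : MemLp f 2) (hg1 : Integrable g) (hg2 : MemLp g 2) :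
    MemLp (𝓕 f) 2 volume ∧
      ∫ x, starRingEnd ℂ (𝓕 f x) * 𝓕 g x = ∫ x, starRingEnd ℂ (f x) * g x := by
  refine ⟨(memLp_congr_ae (fourier_toLp_ae_eq hf1 hf2)).1 (Lp.memLp _), ?_⟩
  have h := Lp.inner_fourier_eq (hf2.toLp f) (hg2.toLp g)
  rw [L2.inner_def, L2.inner_def] at h
  refine Eq.trans ?_ (h.trans ?_)
  · refine integral_congr_ae ?_
    filter_upwards [fourier_toLp_ae_eq hf1 hf2, fourier_toLp_ae_eq hg1 hg2] with x h1 h2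
    rw [h1, h2, RCLike.inner_apply, mul_comm]
  · refine integral_congr_ae ?_
    filter_upwards [hf2.coeFn_toLp, hg2.coeFn_toLp] with x h1 h2
    rw [h1, h2, RCLike.inner_apply, mul_comm]

variable {𝔤 : Type*} [NormedAddCommGroup 𝔤] [NormedSpace ℝ 𝔤] [FiniteDimensional ℝ 𝔤]
  [MeasurableSpace 𝔤] [BorelSpace 𝔤]

/-- The Fourier transform `ξ ↦ ∫ e^{-i⟨Y|ξ⟩} p(Y) dμ(Y)`. -/
def ft (μ : Measure 𝔤) (p : 𝔤 → ℂ) (ξ : StrongDual ℝ 𝔤) : ℂ :=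
  ∫ Y, exp (-(I * (ξ Y : ℂ))) * p Y ∂μ

variable (𝔤) in
/-- The identification of a Euclidean space with the dual of `𝔤` that turns the pairing into
`2π` times the scalar product. -/
def dualEquiv : EuclideanSpace ℝ (Fin (Module.finrank ℝ 𝔤)) ≃L[ℝ] StrongDual ℝ 𝔤 :=
  (LinearEquiv.ofBijective
    ({ toFun := fun w => (2 * Real.pi) • (innerSL ℝ w).comp
          (toEuclidean : 𝔤 ≃L[ℝ] _).toContinuousLinearMap
       map_add' := fun v w => by ext; simp
       map_smul' := fun c w => by ext; simp [mul_left_comm] } :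
      EuclideanSpace ℝ (Fin (Module.finrank ℝ 𝔤)) →ₗ[ℝ] StrongDual ℝ 𝔤)
    ⟨by
      refine (injective_iff_map_eq_zero _).2 fun w hw => ?_
      have h := DFunLike.congr_fun hw (toEuclidean.symm w)
      simpa [Real.pi_ne_zero] using h,
    by
      intro ξ
      refine ⟨(2 * Real.pi)⁻¹ • (InnerProductSpace.toDual ℝ _).symm
        (ξ.comp (toEuclidean : 𝔤 ≃L[ℝ] _).symm.toContinuousLinearMap), ?_⟩
      ext Y
      simp
      field_simp⟩).toContinuousLinearEquiv

theorem dualEquiv_apply (w : EuclideanSpace ℝ (Fin (Module.finrank ℝ 𝔤))) (Y : 𝔤) :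
    dualEquiv 𝔤 w Y = 2 * Real.pi * inner ℝ w (toEuclidean Y) := rfl


theorem exists_eq_smul_map {E V : Type*} [NormedAddCommGroup E] [InnerProductSpace ℝ E]
    [FiniteDimensional ℝ E] [MeasurableSpace E] [BorelSpace E]
    [NormedAddCommGroup V] [NormedSpace ℝ V]
    [MeasurableSpace V] [BorelSpace V] (e : E ≃L[ℝ] V) (μ : Measure V) [μ.IsAddHaarMeasure] :
    ∃ c : ENNReal, c ≠ 0 ∧ c ≠ ⊤ ∧ μ = c • (volume : Measure E).map e := by
  have : FiniteDimensional ℝ V := e.toLinearEquiv.finiteDimensional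
  have : ((volume : Measure E).map e).IsAddHaarMeasure := e.isAddHaarMeasure_map volume
  refine ⟨Measure.addHaarScalarFactor μ ((volume : Measure E).map e),
    by exact_mod_cast (Measure.addHaarScalarFactor_pos_of_isAddHaarMeasure _ _).ne', by simp, ?_⟩
  exact Measure.isAddLeftInvariant_eq_smul _ _

section Transport

variable {E V : Type*} [NormedAddCommGroup E] [InnerProductSpace ℝ E]
    [FiniteDimensional ℝ E] [MeasurableSpace E] [BorelSpace E]
    [NormedAddCommGroup V] [NormedSpace ℝ V]
    [MeasurableSpace V] [BorelSpace V] {e : E ≃L[ℝ] V} {μ : Measure V} {c : ENNReal}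

theorem integral_smul_map (h : μ = c • (volume : Measure E).map e) (p : V → ℂ) :
    ∫ x, p x ∂μ = c.toReal * ∫ v, p (e v) := by
  have : ∫ x, p x ∂(volume : Measure E).map e = ∫ v, p (e v) :=
    e.toHomeomorph.measurableEmbedding.integral_map p
  rw [h, integral_smul_measure, this, Complex.real_smul]

theorem memLp_smul_map_iff (h : μ = c • (volume : Measure E).map e) (h0 : c ≠ 0) (ht : c ≠ ⊤)
    (p : V → ℂ) (q : ENNReal) : MemLp p q μ ↔ MemLp (p ∘ e) q volume := by
  have hm : MemLp p q ((volume : Measure E).map e) ↔ MemLp (p ∘ e) q volume :=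
    e.toHomeomorph.measurableEmbedding.memLp_map_measure_iff
  rw [← hm, h]
  refine ⟨fun H => ?_, fun H => H.smul_measure ht⟩
  have := H.smul_measure (c := c⁻¹) (ENNReal.inv_ne_top.2 h0)
  rwa [smul_smul, ENNReal.inv_mul_cancel h0 ht, one_smul] at this

end Transport

/-- The factor `2π` in `dualEquiv` matches the character `e^{-2πi⟨v,w⟩}` of `𝓕`; the constant `c` is
the density of `μ` relative to Lebesgue measure. -/
theorem ft_dualEquiv {μ : Measure 𝔤} {c : ENNReal}
    (h : μ = c • (volume : Measure (EuclideanSpace ℝ (Fin (Module.finrank ℝ 𝔤)))).map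
      (toEuclidean : 𝔤 ≃L[ℝ] _).symm) (p : 𝔤 → ℂ)
    (w : EuclideanSpace ℝ (Fin (Module.finrank ℝ 𝔤))) :
    ft μ p (dualEquiv 𝔤 w) = c.toReal * 𝓕 (p ∘ (toEuclidean : 𝔤 ≃L[ℝ] _).symm) w := by
  rw [ft, integral_smul_map h, Real.fourier_eq']
  congr 1
  refine integral_congr_ae (.of_forall fun v => ?_)
  simp only [dualEquiv_apply, smul_eq_mul, Function.comp_apply, real_inner_comm w]
  congr 2
  simp
  ring

variable {μ : Measure 𝔤} [μ.IsAddHaarMeasure] {ν : Measure (StrongDual ℝ 𝔤)} [ν.IsAddHaarMeasure]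

/-- Fourier inversion at the origin for a bump function with value 1 there reads `c' * c * 1 = 1`;
this is all that the normalization of `ν` has to supply for Plancherel. -/
theorem IsDualHaar.mul_eq_one (hν : IsDualHaar μ ν) {c c' : ENNReal}
    (h : μ = c • (volume : Measure (EuclideanSpace ℝ (Fin (Module.finrank ℝ 𝔤)))).map
      (toEuclidean : 𝔤 ≃L[ℝ] _).symm)
    (h' : ν = c' • (volume : Measure (EuclideanSpace ℝ (Fin (Module.finrank ℝ 𝔤)))).map
      (dualEquiv 𝔤)) : (c'.toReal * c.toReal : ℂ) = 1 := by
  let b : ContDiffBump (0 : 𝔤) := ⟨1, 2, by norm_num, by norm_num⟩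
  have hG1 : HasCompactSupport fun x => (b x : ℂ) :=
    b.hasCompactSupport.comp_left (g := fun t : ℝ => (t : ℂ)) rfl
  have hG2 : ContDiff ℝ ((⊤ : ℕ∞) : WithTop ℕ∞) fun x => (b x : ℂ) :=
    Complex.ofRealCLM.contDiff.comp b.contDiff
  let u : 𝓢(𝔤, ℂ) := hG1.toSchwartzMap hG2
  have hu : u 0 = 1 := by
    change ((b 0 : ℝ) : ℂ) = 1
    rw [b.one_of_mem_closedBall (by simp [b])]
    simp
  let U := SchwartzMap.compCLMOfContinuousLinearEquiv ℂ (toEuclidean : 𝔤 ≃L[ℝ] _).symm u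
  have key := hν u 0
  have h2 : ∀ ξ : StrongDual ℝ 𝔤, exp (I * (ξ 0 : ℂ)) *
      (∫ Y, exp (-(I * (ξ Y : ℂ))) * u Y ∂μ) = ft μ u ξ := fun ξ => by simp [ft]
  simp only [h2, hu] at key
  rw [integral_smul_map h'] at key
  simp only [ft_dualEquiv h] at key
  rw [integral_const_mul] at key
  have h3 : ∫ w, 𝓕 (u ∘ (toEuclidean : 𝔤 ≃L[ℝ] _).symm) w = U 0 := by
    have : 𝓕⁻ (𝓕 U) 0 = U 0 := by rw [FourierPair.fourierInv_fourier_eq]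
    rw [← this, SchwartzMap.fourierInv_coe, Real.fourierInv_eq', SchwartzMap.fourier_coe]
    simp
    rfl
  have h4 : U 0 = 1 := by simp [U, hu]
  rw [h3, h4, mul_one] at key
  exact key

/-- Plancherel's theorem for a dual pair of Haar measures. -/
theorem IsDualHaar.plancherel (hν : IsDualHaar μ ν) {p q : 𝔤 → ℂ} (hp1 : Integrable p μ)
    (hp2 : MemLp p 2 μ) (hq1 : Integrable q μ) (hq2 : MemLp q 2 μ) :
    MemLp (ft μ p) 2 ν ∧
      ∫ ξ, starRingEnd ℂ (ft μ p ξ) * ft μ q ξ ∂ν = ∫ x, starRingEnd ℂ (p x) * q x ∂μ := by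
  obtain ⟨c, h0, ht, h⟩ := exists_eq_smul_map (toEuclidean : 𝔤 ≃L[ℝ] _).symm μ
  obtain ⟨c', h0', ht', h'⟩ := exists_eq_smul_map (dualEquiv 𝔤) ν
  have hcc := hν.mul_eq_one h h'
  have tr : ∀ {p : 𝔤 → ℂ}, Integrable p μ → Integrable (p ∘ (toEuclidean : 𝔤 ≃L[ℝ] _).symm) :=
    fun hp => by
      rw [← memLp_one_iff_integrable] at hp ⊢
      exact (memLp_smul_map_iff h h0 ht _ _).1 hp
  obtain ⟨k1, k2⟩ := plancherel_euclidean (tr hp1) ((memLp_smul_map_iff h h0 ht _ _).1 hp2)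
    (tr hq1) ((memLp_smul_map_iff h h0 ht _ _).1 hq2)
  constructor
  · rw [memLp_smul_map_iff h' h0' ht']
    have : ft μ p ∘ dualEquiv 𝔤 =
        fun w => (c.toReal : ℂ) * 𝓕 (p ∘ (toEuclidean : 𝔤 ≃L[ℝ] _).symm) w := by
      ext w; exact ft_dualEquiv h p w
    rw [this]
    exact k1.const_mul _
  · rw [integral_smul_map h', integral_smul_map h]
    simp only [ft_dualEquiv h, map_mul, conj_ofReal]
    have : ∀ a b : ℂ, (c.toReal : ℂ) * a * (c.toReal * b) = c.toReal * c.toReal * (a * b) :=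
      fun a b => by ring
    simp only [this, integral_const_mul, k2, Function.comp_apply]
    linear_combination (c.toReal *
      ∫ x, starRingEnd ℂ (p ((toEuclidean : 𝔤 ≃L[ℝ] _).symm x)) *
        q ((toEuclidean : 𝔤 ≃L[ℝ] _).symm x)) * hcc

theorem exists_ft_eq (b : 𝓢(StrongDual ℝ 𝔤, ℂ)) : ∃ u : 𝓢(𝔤, ℂ), ft μ u = b := by
  obtain ⟨c, h0, ht, h⟩ := exists_eq_smul_map (toEuclidean : 𝔤 ≃L[ℝ] _).symm μ
  let B := SchwartzMap.compCLMOfContinuousLinearEquiv ℂ (dualEquiv 𝔤) b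
  let u : 𝓢(𝔤, ℂ) := SchwartzMap.compCLMOfContinuousLinearEquiv ℂ (toEuclidean : 𝔤 ≃L[ℝ] _)
    ((c.toReal : ℂ)⁻¹ • 𝓕⁻ B)
  refine ⟨u, ?_⟩
  ext ξ
  obtain ⟨w, rfl⟩ := (dualEquiv 𝔤).surjective ξ
  have : u ∘ (toEuclidean : 𝔤 ≃L[ℝ] _).symm = ((c.toReal : ℂ)⁻¹ • 𝓕⁻ B : 𝓢(_, ℂ)) := by
    ext v; simp [u]
  rw [ft_dualEquiv h, this, ← SchwartzMap.fourier_coe, FourierTransform.fourier_smul,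
    FourierInvPair.fourier_fourierInv_eq]
  have hc : (c.toReal : ℂ) ≠ 0 := by exact_mod_cast (ENNReal.toReal_pos h0 ht).ne'
  simp [B, hc]

end NilpotentWeyl

namespace NilpotentWeyl

open Complex

/-! ### Square integrable functions on products -/

section L2

variable {α β : Type*} [MeasurableSpace α] [MeasurableSpace β] {m : Measure α} {n : Measure β}

theorem inner_toLp {f g : α → ℂ} (hf : MemLp f 2 m) (hg : MemLp g 2 m) :
    inner ℂ (hf.toLp f) (hg.toLp g) = ∫ x, starRingEnd ℂ (f x) * g x ∂m := by
  rw [L2.inner_def]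
  refine integral_congr_ae ?_
  filter_upwards [hf.coeFn_toLp, hg.coeFn_toLp] with x h1 h2
  rw [h1, h2, RCLike.inner_apply, mul_comm]

theorem inner_eq_integral (f g : Lp ℂ 2 m) :
    inner ℂ f g = ∫ x, starRingEnd ℂ (f x) * g x ∂m := by
  rw [L2.inner_def]
  simp only [RCLike.inner_apply, mul_comm]

theorem integrable_conj_mul {f g : α → ℂ} (hf : MemLp f 2 m) (hg : MemLp g 2 m) :
    Integrable (fun x => starRingEnd ℂ (f x) * g x) m :=
  hf.star.integrable_mul hg

theorem integral_conj_mul_self (f : α → ℂ) :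
    ∫ x, starRingEnd ℂ (f x) * f x ∂m = ((∫ x, ‖f x‖ ^ 2 ∂m : ℝ) : ℂ) := by
  refine Eq.trans (integral_congr_ae (.of_forall fun x => ?_)) integral_ofReal
  simp only [conj_mul']
  push_cast
  rfl

variable [SFinite m] [SFinite n]

theorem memLp_two_prod_iff {f : α × β → ℂ} (hf : AEStronglyMeasurable f (m.prod n)) :
    MemLp f 2 (m.prod n) ↔ (∀ᵐ x ∂m, MemLp (fun y => f (x, y)) 2 n) ∧
      Integrable (fun x => ∫ y, ‖f (x, y)‖ ^ 2 ∂n) m := by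
  rw [memLp_two_iff_integrable_sq_norm hf, integrable_prod_iff (f := fun p => ‖f p‖ ^ 2) (hf.norm.pow 2)]
  refine and_congr (Filter.eventually_congr ?_) (by simp)
  filter_upwards [hf.prodMk_left] with x hx
  rw [memLp_two_iff_integrable_sq_norm hx]

theorem memLp_ae_right {f : α × β → ℂ} (hf : MemLp f 2 (m.prod n)) :
    ∀ᵐ x ∂m, MemLp (fun y => f (x, y)) 2 n :=
  ((memLp_two_prod_iff hf.1).1 hf).1

theorem memLp_tensor {f : α → ℂ} {g : β → ℂ} (hf : MemLp f 2 m) (hg : MemLp g 2 n) :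
    MemLp (fun p : α × β => f p.1 * g p.2) 2 (m.prod n) := by
  refine (memLp_two_iff_integrable_sq_norm (f := fun p : α × β => f p.1 * g p.2)
    (hf.1.comp_fst.mul hg.1.comp_snd)).2 ?_
  simp only [norm_mul, mul_pow]
  exact ((memLp_two_iff_integrable_sq_norm hf.1).1 hf).mul_prod
    ((memLp_two_iff_integrable_sq_norm hg.1).1 hg)

/-- The exceptional null set depends on `b`. Separability of `L²` replaces `D` by a countable dense
subset, hence by one null set, off which every fibre is orthogonal to a dense set. -/
theorem ae_eq_zero_of_forall_ae_inner {f : α × β → ℂ} (hf : MemLp f 2 (m.prod n))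
    [MeasurableSpace.CountablyGenerated β]
    {D : Set (Lp ℂ 2 n)} (hD : Dense D)
    (h : ∀ b ∈ D, ∀ᵐ x ∂m, ∫ y, starRingEnd ℂ (b y) * f (x, y) ∂n = 0) :
    f =ᵐ[m.prod n] 0 := by
  have : Fact ((2 : ENNReal) ≠ ⊤) := ⟨ENNReal.ofNat_ne_top⟩
  obtain ⟨D', hsub, hc, hd⟩ := hD.exists_countable_dense_subset
  have key : ∀ᵐ x ∂m, ∫ y, ‖f (x, y)‖ ^ 2 ∂n = 0 := by
    have := (ae_ball_iff hc).2 fun b hb => h b (hsub hb)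
    filter_upwards [this, memLp_ae_right hf] with x hx hx2
    have h0 : hx2.toLp _ = 0 := by
      refine hd.eq_zero_of_inner_right ℂ fun {b} hb => ?_
      rw [inner_eq_integral, ← hx b hb]
      refine integral_congr_ae ?_
      filter_upwards [hx2.coeFn_toLp] with y hy
      rw [hy]
    have : ∫ y, starRingEnd ℂ (f (x, y)) * f (x, y) ∂n = 0 := by
      rw [← inner_toLp hx2 hx2, h0, inner_zero_left]
    rw [integral_conj_mul_self] at this
    exact_mod_cast this
  have h2 := (memLp_two_iff_integrable_sq_norm hf.1).1 hf
  have h3 : ∫ p, ‖f p‖ ^ 2 ∂(m.prod n) = 0 := by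
    rw [integral_prod _ h2, integral_congr_ae key, integral_zero]
  rw [integral_eq_zero_iff_of_nonneg (fun _ => by positivity) h2] at h3
  filter_upwards [h3] with p hp
  simpa using hp

theorem ae_eq_of_forall_integral_indicator {f : α → ℂ} {g : α → ℂ} {m : Measure α}
    [SigmaFinite m]
    (hf : ∀ s, MeasurableSet s → m s < ⊤ → IntegrableOn f s m)
    (hg : ∀ s, MeasurableSet s → m s < ⊤ → IntegrableOn g s m)
    (h : ∀ s, MeasurableSet s → m s < ⊤ → ∫ x in s, f x ∂m = ∫ x in s, g x ∂m) :
    f =ᵐ[m] g := by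
  have : (f - g) =ᵐ[m] 0 := by
    refine ae_eq_zero_of_forall_setIntegral_eq_of_sigmaFinite
      (fun s hs hms => (hf s hs hms).sub (hg s hs hms)) fun s hs hms => ?_
    simp only [Pi.sub_apply]
    rw [integral_sub (hf s hs hms) (hg s hs hms), h s hs hms, sub_self]
  filter_upwards [this] with x hx
  exact sub_eq_zero.1 hx

/-- Meant for `f` that is square integrable over the product only after the first variable is cut
off to a set of finite measure, such as a function of the second variable alone. -/
theorem integrableOn_fiber_inner {f g : α × β → ℂ} {s : Set α} (hs : MeasurableSet s)
    (hf : MemLp (fun p => s.indicator (fun _ => (1 : ℂ)) p.1 * f p) 2 (m.prod n))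
    (hg : MemLp g 2 (m.prod n)) :
    IntegrableOn (fun x => ∫ y, starRingEnd ℂ (f (x, y)) * g (x, y) ∂n) s m ∧
      ∫ x in s, ∫ y, starRingEnd ℂ (f (x, y)) * g (x, y) ∂n ∂m =
        ∫ p, starRingEnd ℂ (s.indicator (fun _ => (1 : ℂ)) p.1 * f p) * g p ∂(m.prod n) := by
  have hi := integrable_conj_mul hf hg
  have e : ∀ x, ∫ y, starRingEnd ℂ (s.indicator (fun _ => (1 : ℂ)) x * f (x, y)) * g (x, y) ∂n =
      s.indicator (fun x => ∫ y, starRingEnd ℂ (f (x, y)) * g (x, y) ∂n) x := fun x => by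
    by_cases hx : x ∈ s <;> simp [hx]
  constructor
  · rw [← integrable_indicator_iff hs]
    refine hi.integral_prod_left.congr (.of_forall fun x => ?_)
    exact e x
  · rw [integral_prod _ hi, ← integral_indicator hs]
    exact integral_congr_ae (.of_forall fun x => (e x).symm)

end L2

variable {𝔤 : Type*} [NormedAddCommGroup 𝔤] [NormedSpace ℝ 𝔤] [FiniteDimensional ℝ 𝔤]
  [MeasurableSpace 𝔤] [BorelSpace 𝔤]

/-! ### The partial Fourier transform -/

/-- The Fourier transform in the second variable. -/
def pft (μ : Measure 𝔤) (K : 𝔤 × 𝔤 → ℂ) (p : Phase 𝔤) : ℂ :=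
  ft μ (fun W => K (p.1, W)) p.2

variable {μ : Measure 𝔤} [μ.IsAddHaarMeasure] {ν : Measure (StrongDual ℝ 𝔤)} [ν.IsAddHaarMeasure]

theorem ft_congr_ae {p q : 𝔤 → ℂ} (h : p =ᵐ[μ] q) : ft μ p = ft μ q := by
  ext ξ
  refine integral_congr_ae ?_
  filter_upwards [h] with x hx
  rw [hx]

theorem ft_add {p q : 𝔤 → ℂ} (hp : Integrable p μ) (hq : Integrable q μ)
    (ξ : StrongDual ℝ 𝔤) : ft μ (fun x => p x + q x) ξ = ft μ p ξ + ft μ q ξ := by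
  have key : ∀ {p : 𝔤 → ℂ}, Integrable p μ →
      Integrable (fun Y => exp (-(I * (ξ Y : ℂ))) * p Y) μ := fun {p} hp => by
    refine hp.bdd_mul (c := 1) (Continuous.aestronglyMeasurable (by fun_prop))
      (.of_forall fun Y => ?_)
    have : -(I * (ξ Y : ℂ)) = ((-(ξ Y) : ℝ) : ℂ) * I := by push_cast; ring
    rw [this, norm_exp_ofReal_mul_I]
  simp only [ft, mul_add]
  exact integral_add (key hp) (key hq)

theorem ft_const_mul (c : ℂ) (p : 𝔤 → ℂ) (ξ : StrongDual ℝ 𝔤) :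
    ft μ (fun x => c * p x) ξ = c * ft μ p ξ := by
  simp only [ft, ← integral_const_mul]
  congr 1; ext; ring

theorem ae_prod_of_ae_left {α β : Type*} [MeasurableSpace α] [MeasurableSpace β] {m : Measure α}
    {n : Measure β} [SFinite n] {P : α → Prop} (h : ∀ᵐ x ∂m, P x) : ∀ᵐ p ∂(m.prod n), P p.1 :=
  Measure.quasiMeasurePreserving_fst.ae h

theorem pft_congr_ae {K L : 𝔤 × 𝔤 → ℂ} (h : K =ᵐ[μ.prod μ] L) :
    pft μ K =ᵐ[μ.prod ν] pft μ L := by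
  filter_upwards [ae_prod_of_ae_left (n := ν) (Measure.ae_ae_of_ae_prod h)] with p hp
  exact congrFun (ft_congr_ae hp) p.2

theorem aestronglyMeasurable_pft {K : 𝔤 × 𝔤 → ℂ} (hK : AEStronglyMeasurable K (μ.prod μ)) :
    AEStronglyMeasurable (pft μ K) (μ.prod ν) := by
  refine AEStronglyMeasurable.congr ?_ (pft_congr_ae hK.ae_eq_mk.symm)
  refine StronglyMeasurable.aestronglyMeasurable ?_
  refine StronglyMeasurable.integral_prod_right' (ν := μ)
    (f := fun q : Phase 𝔤 × 𝔤 => exp (-(I * (q.1.2 q.2 : ℂ))) * hK.mk K (q.1.1, q.2)) ?_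
  have : Continuous fun q : Phase 𝔤 × 𝔤 => exp (-(I * (q.1.2 q.2 : ℂ))) := by
    have : Continuous fun q : Phase 𝔤 × 𝔤 => q.1.2 q.2 :=
      (continuous_snd.comp continuous_fst).clm_apply continuous_snd
    fun_prop
  exact this.stronglyMeasurable.mul (hK.stronglyMeasurable_mk.comp_measurable (by fun_prop))

theorem memLp_pft (hν : IsDualHaar μ ν) {K : 𝔤 × 𝔤 → ℂ} (hK : MemLp K 2 (μ.prod μ))
    (hK1 : ∀ᵐ X ∂μ, Integrable (fun W => K (X, W)) μ) : MemLp (pft μ K) 2 (μ.prod ν) := by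
  obtain ⟨h1, h2⟩ := (memLp_two_prod_iff hK.1).1 hK
  refine (memLp_two_prod_iff (aestronglyMeasurable_pft hK.1)).2 ⟨?_, h2.congr ?_⟩
  · filter_upwards [hK1, h1] with X hX1 hX2
    exact (hν.plancherel hX1 hX2 hX1 hX2).1
  · filter_upwards [hK1, h1] with X hX1 hX2
    have := (hν.plancherel hX1 hX2 hX1 hX2).2
    rw [integral_conj_mul_self, integral_conj_mul_self] at this
    exact_mod_cast this.symm

theorem integral_conj_pft_mul (hν : IsDualHaar μ ν) {K L : 𝔤 × 𝔤 → ℂ}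
    (hK : MemLp K 2 (μ.prod μ)) (hK1 : ∀ᵐ X ∂μ, Integrable (fun W => K (X, W)) μ)
    (hL : MemLp L 2 (μ.prod μ)) (hL1 : ∀ᵐ X ∂μ, Integrable (fun W => L (X, W)) μ) :
    ∫ p, starRingEnd ℂ (pft μ K p) * pft μ L p ∂(μ.prod ν) =
      ∫ p, starRingEnd ℂ (K p) * L p ∂(μ.prod μ) := by
  rw [integral_prod _ (integrable_conj_mul hK hL),
    integral_prod _ (integrable_conj_mul (memLp_pft hν hK hK1) (memLp_pft hν hL hL1))]
  refine integral_congr_ae ?_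
  filter_upwards [hK1, hL1, memLp_ae_right hK, memLp_ae_right hL] with X k1 l1 k2 l2
  exact (hν.plancherel k1 k2 l1 l2).2

theorem ae_integrable_schwartz (K : 𝓢(𝔤 × 𝔤, ℂ)) :
    ∀ᵐ X ∂μ, Integrable (fun W => K (X, W)) μ :=
  (K.integrable (μ := μ.prod μ)).prod_right_ae

/-- The partial Fourier transform on Schwartz functions, with values in `L²`. -/
def pftSchwartz (hν : IsDualHaar μ ν) : 𝓢(𝔤 × 𝔤, ℂ) →ₗ[ℂ] Lp ℂ 2 (μ.prod ν) where
  toFun K := (memLp_pft hν (K.memLp 2 _) (ae_integrable_schwartz K)).toLp _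
  map_add' K L := by
    rw [← MemLp.toLp_add]
    refine MemLp.toLp_congr _ _ ?_
    filter_upwards [ae_prod_of_ae_left (n := ν) (ae_integrable_schwartz (μ := μ) K),
      ae_prod_of_ae_left (n := ν) (ae_integrable_schwartz (μ := μ) L)] with p hK hL
    exact ft_add hK hL p.2
  map_smul' c K := by
    rw [RingHom.id_apply, ← MemLp.toLp_const_smul]
    exact MemLp.toLp_congr _ _ (.of_forall fun p => ft_const_mul c _ p.2)

theorem norm_pftSchwartz (hν : IsDualHaar μ ν) (K : 𝓢(𝔤 × 𝔤, ℂ)) :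
    ‖pftSchwartz hν K‖ = ‖K.toLp 2 (μ.prod μ)‖ := by
  have h : inner ℂ (pftSchwartz hν K) (pftSchwartz hν K) =
      inner ℂ (K.toLp 2 (μ.prod μ)) (K.toLp 2 (μ.prod μ)) := by
    have h1 := ae_integrable_schwartz (μ := μ) K
    have h2 := K.memLp 2 (μ.prod μ)
    have h3 := memLp_pft hν h2 h1
    exact (inner_toLp h3 h3).trans ((integral_conj_pft_mul hν h2 h1 h2 h1).trans
      (inner_toLp h2 h2).symm)
  rw [inner_self_eq_norm_sq_to_K, inner_self_eq_norm_sq_to_K] at h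
  have h' : ‖pftSchwartz hν K‖ ^ 2 = ‖K.toLp 2 (μ.prod μ)‖ ^ 2 := by exact_mod_cast h
  exact (sq_eq_sq₀ (norm_nonneg _) (norm_nonneg _)).1 h'

theorem denseRange_toLp_prod :
    DenseRange (SchwartzMap.toLpCLM ℂ (E := 𝔤 × 𝔤) ℂ 2 (μ.prod μ)).toLinearMap :=
  SchwartzMap.denseRange_toLpCLM ENNReal.ofNat_ne_top

/-- The partial Fourier transform as an isometry of `L²` spaces. -/
def pftL2 (hν : IsDualHaar μ ν) : Lp ℂ 2 (μ.prod μ) →ₗᵢ[ℂ] Lp ℂ 2 (μ.prod ν) where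
  toLinearMap := ((pftSchwartz hν).extendOfNorm
    (SchwartzMap.toLpCLM ℂ (E := 𝔤 × 𝔤) ℂ 2 (μ.prod μ)).toLinearMap).toLinearMap
  norm_map' K := by
    refine denseRange_toLp_prod.induction_on K
      (isClosed_eq (ContinuousLinearMap.continuous _).norm continuous_norm) fun K => ?_
    change ‖(pftSchwartz hν).extendOfNorm _ _‖ = _
    rw [LinearMap.extendOfNorm_eq denseRange_toLp_prod
      ⟨1, fun K => by rw [one_mul]; exact (norm_pftSchwartz hν K).le⟩, norm_pftSchwartz]
    rfl

theorem pftL2_schwartz (hν : IsDualHaar μ ν) (K : 𝓢(𝔤 × 𝔤, ℂ)) :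
    pftL2 hν (K.toLp 2 (μ.prod μ)) = pftSchwartz hν K :=
  LinearMap.extendOfNorm_eq denseRange_toLp_prod
    ⟨1, fun K => by rw [one_mul]; exact (norm_pftSchwartz hν K).le⟩ K

/-- Identifies the extension by density with the fibrewise integral whenever the latter makes sense.
No approximation of `V` is needed: `P` has the norm of `V` and pairs with the range as `V` does, so
expanding `‖P - pftL2 V‖²` gives zero. -/
theorem pftL2_toLp (hν : IsDualHaar μ ν) {V : 𝔤 × 𝔤 → ℂ}
    (hV : MemLp V 2 (μ.prod μ)) (hV1 : ∀ᵐ X ∂μ, Integrable (fun W => V (X, W)) μ) :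
    pftL2 hν (hV.toLp V) = (memLp_pft hν hV hV1).toLp _ := by
  set P := (memLp_pft hν hV hV1).toLp _ with hP
  have h1 : ∀ K, inner ℂ P (pftL2 hν K) = inner ℂ (hV.toLp V) K := fun K => by
    refine denseRange_toLp_prod.induction_on K (isClosed_eq ?_ ?_) fun K => ?_
    · exact continuous_const.inner (pftL2 hν).continuous
    · exact continuous_const.inner continuous_id
    · have h1 := ae_integrable_schwartz (μ := μ) K
      have h2 := K.memLp 2 (μ.prod μ)
      change inner ℂ P (pftL2 hν (K.toLp 2 (μ.prod μ))) = inner ℂ _ (K.toLp 2 (μ.prod μ))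
      rw [pftL2_schwartz]
      exact (inner_toLp _ (memLp_pft hν h2 h1)).trans
        ((integral_conj_pft_mul hν hV hV1 h2 h1).trans
        (inner_toLp hV h2).symm)
  have h2 : ‖P‖ = ‖hV.toLp V‖ := by
    have : inner ℂ P P = inner ℂ (hV.toLp V) (hV.toLp V) :=
      (inner_toLp _ _).trans ((integral_conj_pft_mul hν hV hV1 hV hV1).trans
        (inner_toLp hV hV).symm)
    rw [inner_self_eq_norm_sq_to_K, inner_self_eq_norm_sq_to_K] at this
    have h' : ‖P‖ ^ 2 = ‖hV.toLp V‖ ^ 2 := by exact_mod_cast this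
    exact (sq_eq_sq₀ (norm_nonneg _) (norm_nonneg _)).1 h'
  have h3 : ‖P - pftL2 hν (hV.toLp V)‖ ^ 2 = 0 := by
    rw [@norm_sub_sq ℂ, h1, h2, LinearIsometry.norm_map, inner_self_eq_norm_sq]
    ring
  exact (sub_eq_zero.1 (norm_eq_zero.1 (pow_eq_zero_iff two_ne_zero |>.1 h3))).symm

variable (μ ν) in
theorem dense_range_ft :
    Dense {b : Lp ℂ 2 ν | ∃ u : 𝓢(𝔤, ℂ), b =ᵐ[ν] ft μ u} := by
  have h : DenseRange (SchwartzMap.toLpCLM ℂ (E := StrongDual ℝ 𝔤) ℂ 2 ν) :=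
    SchwartzMap.denseRange_toLpCLM ENNReal.ofNat_ne_top
  refine h.mono ?_
  rintro _ ⟨b, rfl⟩
  obtain ⟨u, hu⟩ := exists_ft_eq (μ := μ) b
  exact ⟨u, by rw [hu]; exact b.coeFn_toLp 2 ν⟩

/-- The range of an isometry is closed, so it suffices that an `F` orthogonal to it vanishes.
Testing on `1_s ⊗ u` with `s` arbitrary shows that almost every fibre of `F` is orthogonal to `ft μ
u`, and these transforms are dense. -/
theorem pftL2_surjective (hν : IsDualHaar μ ν) : Function.Surjective (pftL2 hν) := by
  have hc : IsClosed (Set.range (pftL2 hν)) :=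
    (pftL2 hν).isometry.isClosedEmbedding.isClosed_range
  have hcomp : IsComplete ((pftL2 hν).range : Set (Lp ℂ 2 (μ.prod ν))) := hc.isComplete
  have : CompleteSpace (pftL2 hν).range := hcomp.completeSpace_coe
  suffices h : (pftL2 hν).range = ⊤ by
    intro F
    have : F ∈ (pftL2 hν).range := h ▸ Submodule.mem_top
    exact this
  rw [← Submodule.orthogonal_eq_bot_iff, Submodule.eq_bot_iff]
  intro F hF
  rw [Submodule.mem_orthogonal] at hF
  rw [Lp.eq_zero_iff_ae_eq_zero]
  refine ae_eq_zero_of_forall_ae_inner (Lp.memLp F) (dense_range_ft μ ν) ?_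
  rintro b ⟨u, hu⟩
  have hV : ∀ s : Set 𝔤, MeasurableSet s → μ s < ⊤ →
      MemLp (fun p : 𝔤 × 𝔤 => s.indicator (fun _ => (1 : ℂ)) p.1 * u p.2) 2 (μ.prod μ) :=
    fun s hs hms => memLp_tensor (memLp_indicator_const 2 hs 1 (.inr hms.ne)) (u.memLp 2 μ)
  have hV1 : ∀ s : Set 𝔤, ∀ᵐ X ∂μ,
      Integrable (fun W => s.indicator (fun _ => (1 : ℂ)) X * u W) μ :=
    fun s => .of_forall fun X => (u.integrable (μ := μ)).const_mul _
  have hV2 : ∀ s : Set 𝔤, pft μ (fun p : 𝔤 × 𝔤 => s.indicator (fun _ => (1 : ℂ)) p.1 * u p.2) =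
      fun p => s.indicator (fun _ => (1 : ℂ)) p.1 * ft μ u p.2 := fun s => by
    ext p; exact ft_const_mul (μ := μ) (s.indicator (fun _ => (1 : ℂ)) p.1) u p.2
  have hM : ∀ s : Set 𝔤, MeasurableSet s → μ s < ⊤ →
      MemLp (fun p : Phase 𝔤 => s.indicator (fun _ => (1 : ℂ)) p.1 * ft μ u p.2) 2 (μ.prod ν) :=
    fun s hs hms => hV2 s ▸ memLp_pft hν (hV s hs hms) (hV1 s)
  have hfib := fun s hs hms =>
    integrableOn_fiber_inner (f := fun p : Phase 𝔤 => ft μ u p.2) hs (hM s hs hms) (Lp.memLp F)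
  have h0 : (fun X => ∫ ξ, starRingEnd ℂ (ft μ u ξ) * F (X, ξ) ∂ν) =ᵐ[μ] 0 := by
    refine ae_eq_of_forall_integral_indicator (fun s hs hms => (hfib s hs hms).1)
      (fun s hs hms => integrableOn_zero) fun s hs hms => ?_
    rw [(hfib s hs hms).2]
    have := hF _ ⟨(hV s hs hms).toLp _, rfl⟩
    rw [LinearIsometry.coe_toLinearMap, pftL2_toLp hν _ (hV1 s)] at this
    simp only [Pi.zero_apply, integral_zero]
    rw [← this, inner_eq_integral]
    refine integral_congr_ae ?_
    filter_upwards [(memLp_pft hν (hV s hs hms) (hV1 s)).coeFn_toLp] with p hp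
    rw [hp, hV2]
  filter_upwards [h0] with X hX
  rw [Pi.zero_apply] at hX
  rw [← hX]
  refine integral_congr_ae ?_
  filter_upwards [hu] with ξ hξ
  rw [hξ]

/-- The partial Fourier transform as a unitary operator. -/
def pftEquiv (hν : IsDualHaar μ ν) : Lp ℂ 2 (μ.prod μ) ≃ₗᵢ[ℂ] Lp ℂ 2 (μ.prod ν) :=
  LinearIsometryEquiv.ofSurjective (pftL2 hν) (pftL2_surjective hν)

theorem integral_conj_pft_mul_pftEquiv (hν : IsDualHaar μ ν) {V : 𝔤 × 𝔤 → ℂ}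
    (hV : MemLp V 2 (μ.prod μ)) (hV1 : ∀ᵐ X ∂μ, Integrable (fun W => V (X, W)) μ)
    (K : Lp ℂ 2 (μ.prod μ)) :
    ∫ p, starRingEnd ℂ (pft μ V p) * pftEquiv hν K p ∂(μ.prod ν) =
      ∫ p, starRingEnd ℂ (V p) * K p ∂(μ.prod μ) := by
  have h := (pftL2 hν).inner_map_map (hV.toLp V) K
  rw [pftL2_toLp hν hV hV1, inner_eq_integral, inner_eq_integral] at h
  refine Eq.trans ?_ (h.trans ?_)
  · refine integral_congr_ae ?_
    filter_upwards [(memLp_pft hν hV hV1).coeFn_toLp] with p hp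
    rw [hp]; rfl
  · refine integral_congr_ae ?_
    filter_upwards [hV.coeFn_toLp] with p hp
    rw [hp]

end NilpotentWeyl

namespace NilpotentWeyl

open Complex

/-! ### Operators with square integrable kernels -/

section Kernels

variable {α : Type*} [MeasurableSpace α]

/-- The operator `T` has the integral kernel `k`. -/
def HasKer (m : Measure α) (T : Lp ℂ 2 m →L[ℂ] Lp ℂ 2 m) (k : α × α → ℂ) : Prop :=
  ∀ u : Lp ℂ 2 m, T u =ᵐ[m] fun x => ∫ y, k (x, y) * u y ∂m

/-- The kernel of a product of operators. -/
def kcomp (m : Measure α) (k l : α × α → ℂ) (p : α × α) : ℂ := ∫ y, k (p.1, y) * l (y, p.2) ∂m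

/-- The kernel of the adjoint. -/
def kadj (k : α × α → ℂ) (p : α × α) : ℂ := starRingEnd ℂ (k p.swap)

variable {m : Measure α}

theorem norm_integral_mul_sq_le {f g : α → ℂ} (hf : MemLp f 2 m) (hg : MemLp g 2 m) :
    ‖∫ x, f x * g x ∂m‖ ^ 2 ≤ (∫ x, ‖f x‖ ^ 2 ∂m) * ∫ x, ‖g x‖ ^ 2 ∂m := by
  have hn : ∀ {f : α → ℂ} (hf : MemLp f 2 m), ‖hf.toLp f‖ ^ 2 = ∫ x, ‖f x‖ ^ 2 ∂m := by
    intro f hf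
    rw [← inner_self_eq_norm_sq (𝕜 := ℂ), inner_toLp, integral_conj_mul_self]
    exact ofReal_re _
  have h := inner_toLp hf.star hg
  simp only [Pi.star_apply, RCLike.star_def, conj_conj] at h
  have h2 : (∫ x, ‖f x‖ ^ 2 ∂m) = ∫ x, ‖star f x‖ ^ 2 ∂m := by simp
  rw [h2, ← hn hf.star, ← hn hg, ← h, ← mul_pow]
  gcongr
  exact norm_inner_le_norm _ _

variable [SFinite m]

theorem memLp_kernel_apply {k : α × α → ℂ} (hk : MemLp k 2 (m.prod m)) {u : α → ℂ}
    (hu : MemLp u 2 m) :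
    MemLp (fun x => ∫ y, k (x, y) * u y ∂m) 2 m ∧
      ∫ x, ‖∫ y, k (x, y) * u y ∂m‖ ^ 2 ∂m ≤
        (∫ p, ‖k p‖ ^ 2 ∂(m.prod m)) * ∫ y, ‖u y‖ ^ 2 ∂m := by
  have hmeas : AEStronglyMeasurable (fun x => ∫ y, k (x, y) * u y ∂m) m :=
    AEStronglyMeasurable.integral_prod_right' (f := fun p : α × α => k p * u p.2)
      (hk.1.mul hu.1.comp_snd)
  obtain ⟨h1, h2⟩ := (memLp_two_prod_iff hk.1).1 hk
  have hb : ∀ᵐ x ∂m, ‖∫ y, k (x, y) * u y ∂m‖ ^ 2 ≤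
      (∫ y, ‖k (x, y)‖ ^ 2 ∂m) * ∫ y, ‖u y‖ ^ 2 ∂m := by
    filter_upwards [h1] with x hx
    exact norm_integral_mul_sq_le hx hu
  have hi := h2.mul_const (∫ y, ‖u y‖ ^ 2 ∂m)
  have hi2 : Integrable (fun x => ‖∫ y, k (x, y) * u y ∂m‖ ^ 2) m := by
    refine hi.mono' (hmeas.norm.pow 2) ?_
    filter_upwards [hb] with x hx
    rwa [Real.norm_of_nonneg (by positivity)]
  refine ⟨(memLp_two_iff_integrable_sq_norm hmeas).2 hi2, ?_⟩
  rw [integral_prod _ ((memLp_two_iff_integrable_sq_norm hk.1).1 hk), ← integral_mul_const]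
  exact integral_mono_ae hi2 hi hb

theorem norm_sq_eq_integral (f : Lp ℂ 2 m) : ‖f‖ ^ 2 = ∫ x, ‖f x‖ ^ 2 ∂m := by
  rw [← inner_self_eq_norm_sq (𝕜 := ℂ), inner_eq_integral, integral_conj_mul_self]
  exact ofReal_re _

theorem exists_hasKer {k : α × α → ℂ} (hk : MemLp k 2 (m.prod m)) : ∃ T, HasKer m T k := by
  have hint : ∀ u : Lp ℂ 2 m, ∀ᵐ x ∂m, Integrable (fun y => k (x, y) * u y) m := fun u => by
    filter_upwards [memLp_ae_right hk] with x hx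
    exact hx.integrable_mul (Lp.memLp u)
  let L : Lp ℂ 2 m →ₗ[ℂ] Lp ℂ 2 m :=
    { toFun := fun u => (memLp_kernel_apply hk (Lp.memLp u)).1.toLp _
      map_add' := fun u v => by
        rw [← MemLp.toLp_add]
        refine MemLp.toLp_congr _ _ ?_
        filter_upwards [hint u, hint v] with x hu hv
        rw [Pi.add_apply, ← integral_add hu hv]
        refine integral_congr_ae ?_
        filter_upwards [Lp.coeFn_add u v] with y hy
        rw [hy, Pi.add_apply, mul_add]
      map_smul' := fun c u => by
        rw [RingHom.id_apply, ← MemLp.toLp_const_smul]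
        refine MemLp.toLp_congr _ _ (.of_forall fun x => ?_)
        simp only [Pi.smul_apply, smul_eq_mul]
        rw [← integral_const_mul]
        refine integral_congr_ae ?_
        filter_upwards [Lp.coeFn_smul c u] with y hy
        rw [hy, Pi.smul_apply, smul_eq_mul, mul_left_comm] }
  refine ⟨L.mkContinuous (Real.sqrt (∫ p, ‖k p‖ ^ 2 ∂(m.prod m))) fun u => ?_,
    fun u => (memLp_kernel_apply hk (Lp.memLp u)).1.coeFn_toLp⟩
  have h0 : 0 ≤ ∫ p, ‖k p‖ ^ 2 ∂(m.prod m) := integral_nonneg fun _ => by positivity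
  rw [← sq_le_sq₀ (norm_nonneg _) (by positivity), mul_pow, Real.sq_sqrt h0,
    norm_sq_eq_integral u]
  refine le_trans (le_of_eq ?_) (memLp_kernel_apply hk (Lp.memLp u)).2
  rw [norm_sq_eq_integral]
  refine integral_congr_ae ?_
  filter_upwards [(memLp_kernel_apply hk (Lp.memLp u)).1.coeFn_toLp] with x hx
  change ‖((memLp_kernel_apply hk (Lp.memLp u)).1.toLp _) x‖ ^ 2 = _
  rw [hx]

theorem HasKer.congr {T : Lp ℂ 2 m →L[ℂ] Lp ℂ 2 m} {k k' : α × α → ℂ} (h : HasKer m T k)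
    (hk : k =ᵐ[m.prod m] k') : HasKer m T k' := fun u => by
  filter_upwards [h u, Measure.ae_ae_of_ae_prod hk] with x hx hx2
  rw [hx]
  refine integral_congr_ae ?_
  filter_upwards [hx2] with y hy
  rw [hy]

theorem HasKer.op_ext {T S : Lp ℂ 2 m →L[ℂ] Lp ℂ 2 m} {k : α × α → ℂ} (h : HasKer m T k)
    (h' : HasKer m S k) : T = S := by
  ext1 u
  exact Lp.ext ((h u).trans (h' u).symm)

theorem HasKer.ker_ext [MeasurableSpace.CountablyGenerated α]
    {T : Lp ℂ 2 m →L[ℂ] Lp ℂ 2 m} {k k' : α × α → ℂ} (h : HasKer m T k)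
    (h' : HasKer m T k') (hk : MemLp k 2 (m.prod m)) (hk' : MemLp k' 2 (m.prod m)) :
    k =ᵐ[m.prod m] k' := by
  have : (k - k') =ᵐ[m.prod m] 0 := by
    refine ae_eq_zero_of_forall_ae_inner (hk.sub hk') dense_univ fun b _ => ?_
    have hb := (Lp.memLp b).star
    filter_upwards [h (hb.toLp _), h' (hb.toLp _), memLp_ae_right hk, memLp_ae_right hk']
      with x h1 h2 m1 m2
    have h3 := h1.symm.trans h2
    have e : ∀ k : α × α → ℂ, ∫ y, k (x, y) * (hb.toLp _) y ∂m =
        ∫ y, starRingEnd ℂ (b y) * k (x, y) ∂m := fun k => by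
      refine integral_congr_ae ?_
      filter_upwards [hb.coeFn_toLp] with y hy
      rw [hy, mul_comm]; rfl
    rw [e, e] at h3
    simp only [Pi.sub_apply, mul_sub]
    rw [integral_sub (integrable_conj_mul (Lp.memLp b) m1)
      (integrable_conj_mul (Lp.memLp b) m2), h3, sub_self]
  filter_upwards [this] with p hp
  exact sub_eq_zero.1 hp

theorem memLp_kadj {k : α × α → ℂ} (hk : MemLp k 2 (m.prod m)) :
    MemLp (kadj k) 2 (m.prod m) :=
  (hk.comp_measurePreserving Measure.measurePreserving_swap).star

theorem kadj_kadj (k : α × α → ℂ) : kadj (kadj k) = k := by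
  ext p; simp [kadj]

theorem aestronglyMeasurable_kcomp {k l : α × α → ℂ} (hk : AEStronglyMeasurable k (m.prod m))
    (hl : AEStronglyMeasurable l (m.prod m)) :
    AEStronglyMeasurable (fun q : (α × α) × α => k (q.1.1, q.2) * l (q.2, q.1.2))
      ((m.prod m).prod m) := by
  have h1 : Measure.QuasiMeasurePreserving (fun q : (α × α) × α => (q.1.1, q.2))
      ((m.prod m).prod m) (m.prod m) :=
    MeasureTheory.QuasiMeasurePreserving.prodMap Measure.quasiMeasurePreserving_fst (.id m)
  have h2 : Measure.QuasiMeasurePreserving (fun q : (α × α) × α => (q.1.2, q.2))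
      ((m.prod m).prod m) (m.prod m) :=
    MeasureTheory.QuasiMeasurePreserving.prodMap Measure.quasiMeasurePreserving_snd (.id m)
  have h3 : Measure.QuasiMeasurePreserving (fun q : (α × α) × α => (q.2, q.1.2))
      ((m.prod m).prod m) (m.prod m) :=
    Measure.measurePreserving_swap.quasiMeasurePreserving.comp h2
  exact (hk.comp_quasiMeasurePreserving h1).mul (hl.comp_quasiMeasurePreserving h3)

theorem memLp_swap {k : α × α → ℂ} (hk : MemLp k 2 (m.prod m)) :
    MemLp (fun p => k p.swap) 2 (m.prod m) :=
  hk.comp_measurePreserving Measure.measurePreserving_swap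

theorem memLp_kcomp {k l : α × α → ℂ} (hk : MemLp k 2 (m.prod m)) (hl : MemLp l 2 (m.prod m)) :
    MemLp (kcomp m k l) 2 (m.prod m) := by
  have hmeas : AEStronglyMeasurable (kcomp m k l) (m.prod m) :=
    (aestronglyMeasurable_kcomp hk.1 hl.1).integral_prod_right'
  obtain ⟨h1, h2⟩ := (memLp_two_prod_iff hk.1).1 hk
  have hl' := memLp_swap hl
  obtain ⟨h3, h4⟩ := (memLp_two_prod_iff hl'.1).1 hl'
  refine (memLp_two_iff_integrable_sq_norm hmeas).2 ((h2.mul_prod h4).mono' (hmeas.norm.pow 2) ?_)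
  filter_upwards [ae_prod_of_ae_left (n := m) h1,
    Measure.quasiMeasurePreserving_snd.ae (μa := m.prod m) h3] with p hp1 hp2
  rw [Real.norm_of_nonneg (by positivity)]
  exact norm_integral_mul_sq_le hp1 hp2

theorem HasKer.comp {T S : Lp ℂ 2 m →L[ℂ] Lp ℂ 2 m} {k l : α × α → ℂ} (hT : HasKer m T k)
    (hS : HasKer m S l) (hk : MemLp k 2 (m.prod m)) (hl : MemLp l 2 (m.prod m)) :
    HasKer m (T ∘L S) (kcomp m k l) := fun u => by
  have hu := Lp.memLp u
  filter_upwards [hT (S u), memLp_ae_right hk] with x hx hkx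
  rw [ContinuousLinearMap.comp_apply, hx]
  have e1 : ∫ y, k (x, y) * S u y ∂m = ∫ y, ∫ z, k (x, y) * (l (y, z) * u z) ∂m ∂m := by
    refine integral_congr_ae ?_
    filter_upwards [hS u] with y hy
    rw [hy, integral_const_mul]
  -- Fubini applies since `k (x, ·) ⊗ u` and `l` are both square integrable on the product.
  have hi : Integrable (fun p : α × α => k (x, p.1) * (l p * u p.2)) (m.prod m) := by
    refine ((memLp_tensor hkx hu).integrable_mul hl).congr (.of_forall fun p => ?_)
    simp only [Pi.mul_apply]
    ring
  rw [e1, integral_integral_swap hi]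
  refine integral_congr_ae (.of_forall fun z => ?_)
  simp only [kcomp, ← integral_mul_const, mul_assoc]

theorem HasKer.adjoint {T : Lp ℂ 2 m →L[ℂ] Lp ℂ 2 m} {k : α × α → ℂ} (hT : HasKer m T k)
    (hk : MemLp k 2 (m.prod m)) : HasKer m (ContinuousLinearMap.adjoint T) (kadj k) := by
  obtain ⟨S, hS⟩ := exists_hasKer (memLp_kadj hk)
  suffices h : S = ContinuousLinearMap.adjoint T by rwa [← h]
  rw [ContinuousLinearMap.eq_adjoint_iff]
  intro u w
  rw [inner_eq_integral, inner_eq_integral]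
  have hi : Integrable (fun p : α × α => starRingEnd ℂ (u p.1) * (k p * w p.2)) (m.prod m) := by
    refine ((memLp_tensor (Lp.memLp u).star (Lp.memLp w)).integrable_mul hk).congr
      (.of_forall fun p => ?_)
    simp only [Pi.mul_apply, Pi.star_apply, RCLike.star_def]
    ring
  have e1 : ∫ x, starRingEnd ℂ (u x) * T w x ∂m =
      ∫ x, ∫ y, starRingEnd ℂ (u x) * (k (x, y) * w y) ∂m ∂m := by
    refine integral_congr_ae ?_
    filter_upwards [hT w] with y hy
    rw [hy, integral_const_mul]
  rw [e1, integral_integral_swap hi]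
  refine integral_congr_ae ?_
  filter_upwards [hS u] with y hy
  rw [hy, ← integral_conj, ← integral_mul_const]
  congr 1
  ext x
  simp only [kadj, Prod.swap_prod_mk, map_mul, conj_conj]
  ring

/-- `U` is the weighted composition operator `u ↦ c · (u ∘ σ)`. -/
def IsWeighted (m : Measure α) (U : Lp ℂ 2 m →L[ℂ] Lp ℂ 2 m) (c : α → ℂ) (σ : α → α) : Prop :=
  ∀ u : Lp ℂ 2 m, U u =ᵐ[m] fun x => c x * u (σ x)

theorem memLp_phase_mul {c : α → ℂ} (hc : Measurable c) (hc1 : ∀ x, ‖c x‖ = 1)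
    {u : α → ℂ} (hu : MemLp u 2 m) : MemLp (fun x => c x * u x) 2 m := by
  refine hu.of_le (hc.aestronglyMeasurable.mul hu.1) (.of_forall fun x => ?_)
  rw [norm_mul, hc1, one_mul]

theorem exists_isWeighted {c : α → ℂ} {σ : α → α} (hc : Measurable c) (hc1 : ∀ x, ‖c x‖ = 1)
    (hσ : MeasurePreserving σ m m) : ∃ U, IsWeighted m U c σ := by
  have hM : ∀ u : Lp ℂ 2 m, MemLp (fun x => c x * u (σ x)) 2 m := fun u =>
    memLp_phase_mul hc hc1 ((Lp.memLp u).comp_measurePreserving hσ)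
  let L : Lp ℂ 2 m →ₗ[ℂ] Lp ℂ 2 m :=
    { toFun := fun u => (hM u).toLp _
      map_add' := fun u v => by
        rw [← MemLp.toLp_add]
        refine MemLp.toLp_congr _ _ ?_
        filter_upwards [hσ.quasiMeasurePreserving.ae (Lp.coeFn_add u v)] with x hx
        rw [hx, Pi.add_apply, Pi.add_apply, mul_add]
      map_smul' := fun a u => by
        rw [RingHom.id_apply, ← MemLp.toLp_const_smul]
        refine MemLp.toLp_congr _ _ ?_
        filter_upwards [hσ.quasiMeasurePreserving.ae (Lp.coeFn_smul a u)] with x hx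
        rw [hx, Pi.smul_apply, Pi.smul_apply, smul_eq_mul, smul_eq_mul, mul_left_comm] }
  refine ⟨L.mkContinuous 1 fun u => ?_, fun u => (hM u).coeFn_toLp⟩
  rw [one_mul]
  change ‖(hM u).toLp _‖ ≤ _
  rw [Lp.norm_toLp, Lp.norm_def]
  refine ENNReal.toReal_mono (Lp.memLp u).2.ne (le_of_eq ?_)
  rw [← eLpNorm_comp_measurePreserving (Lp.memLp u).1 hσ]
  refine eLpNorm_congr_norm_ae (.of_forall fun x => ?_)
  rw [norm_mul, hc1, one_mul]; rfl

theorem memLp_left_twist {c : α → ℂ} {σ : α → α} (hc : Measurable c) (hc1 : ∀ x, ‖c x‖ = 1)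
    (hσ : MeasurePreserving σ m m) {k : α × α → ℂ} (hk : MemLp k 2 (m.prod m)) :
    MemLp (fun p => c p.1 * k (σ p.1, p.2)) 2 (m.prod m) :=
  memLp_phase_mul (c := fun p : α × α => c p.1) (hc.comp measurable_fst) (fun _ => hc1 _)
    (hk.comp_measurePreserving (hσ.prod (MeasurePreserving.id m)))

theorem HasKer.weighted_comp {T U : Lp ℂ 2 m →L[ℂ] Lp ℂ 2 m} {k : α × α → ℂ} {c : α → ℂ}
    {σ : α → α} (hT : HasKer m T k) (hU : IsWeighted m U c σ) (hσ : MeasurePreserving σ m m) :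
    HasKer m (U ∘L T) (fun p => c p.1 * k (σ p.1, p.2)) := fun u => by
  filter_upwards [hU (T u), hσ.quasiMeasurePreserving.ae (hT u)] with x h1 h2
  rw [ContinuousLinearMap.comp_apply, h1, h2, ← integral_const_mul]
  simp only [mul_assoc]

/-- Writing `T U* = (U T*)*` reduces to multiplication from the left and avoids inverting `σ`. -/
theorem HasKer.comp_weighted_adjoint {T U : Lp ℂ 2 m →L[ℂ] Lp ℂ 2 m} {k : α × α → ℂ} {c : α → ℂ}
    {σ : α → α} (hT : HasKer m T k) (hk : MemLp k 2 (m.prod m)) (hU : IsWeighted m U c σ)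
    (hc : Measurable c) (hc1 : ∀ x, ‖c x‖ = 1) (hσ : MeasurePreserving σ m m) :
    HasKer m (T ∘L ContinuousLinearMap.adjoint U)
      (fun p => starRingEnd ℂ (c p.2) * k (p.1, σ p.2)) := by
  have h := ((hT.adjoint hk).weighted_comp hU hσ).adjoint
    (memLp_left_twist hc hc1 hσ (memLp_kadj hk))
  rw [ContinuousLinearMap.adjoint_comp, ContinuousLinearMap.adjoint_adjoint] at h
  convert h using 1
  ext p
  simp [kadj]

end Kernels

end NilpotentWeyl

namespace NilpotentWeyl

variable {𝔤 : Type*} [NormedAddCommGroup 𝔤] [NormedSpace ℝ 𝔤] [FiniteDimensional ℝ 𝔤]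
  [MeasurableSpace 𝔤] [BorelSpace 𝔤] [RealLieStructure 𝔤]

/-! ### Triangular maps with respect to the lower central series -/

variable (𝔤) in
/-- The lower central series, as a sequence of linear subspaces. -/
def lcs (k : ℕ) : Submodule ℝ 𝔤 := (LieModule.lowerCentralSeries ℝ 𝔤 𝔤 k).toSubmodule

theorem mem_lcs_zero (x : 𝔤) : x ∈ lcs 𝔤 0 := by simp [lcs]

theorem lcs_antitone : Antitone (lcs 𝔤) :=
  fun _ _ h => LieModule.antitone_lowerCentralSeries ℝ 𝔤 𝔤 h

theorem lie_mem_lcs_right (x : 𝔤) {y : 𝔤} {k : ℕ} (hy : y ∈ lcs 𝔤 k) : ⁅x, y⁆ ∈ lcs 𝔤 (k + 1) := by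
  simp only [lcs, LieModule.lowerCentralSeries_succ]
  exact LieSubmodule.lie_mem_lie (LieSubmodule.mem_top x) hy

theorem lie_mem_lcs_left {x : 𝔤} (y : 𝔤) {k : ℕ} (hx : x ∈ lcs 𝔤 k) : ⁅x, y⁆ ∈ lcs 𝔤 (k + 1) := by
  rw [← lie_skew]
  exact neg_mem (lie_mem_lcs_right y hx)

/-- A map that improves congruences modulo the lower central series by one step. -/
def Contracting (S : 𝔤 → 𝔤) : Prop :=
  ∀ k x y, x - y ∈ lcs 𝔤 k → S x - S y ∈ lcs 𝔤 (k + 1)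

/-- A map of two variables that improves congruences modulo the lower central series by one
step. -/
def Contracting₂ (R : 𝔤 → 𝔤 → 𝔤) : Prop :=
  ∀ k x x' y y', x - x' ∈ lcs 𝔤 k → y - y' ∈ lcs 𝔤 k → R x y - R x' y' ∈ lcs 𝔤 (k + 1)

theorem Contracting.const_add {S : 𝔤 → 𝔤} (hS : Contracting S) (c : 𝔤) :
    Contracting fun x => c + S x := fun k x y h => by
  rw [add_sub_add_left_eq_sub]; exact hS k x y h

theorem Contracting.neg {S : 𝔤 → 𝔤} (hS : Contracting S) :
    Contracting fun x => -S x := fun k x y h => by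
  rw [neg_sub_neg, ← neg_sub]; exact neg_mem (hS k x y h)

theorem Contracting₂.right {R : 𝔤 → 𝔤 → 𝔤} (hR : Contracting₂ R) (x : 𝔤) : Contracting (R x) :=
  fun k y y' h => hR k x x y y' (by simp) h

section Nilpotent

variable [LieRing.IsNilpotent 𝔤]

variable (𝔤) in
theorem exists_lcs_eq_bot : ∃ n, lcs 𝔤 n = ⊥ := by
  obtain ⟨n, hn⟩ := (LieModule.isNilpotent_iff ℝ 𝔤 𝔤).1 inferInstance
  exact ⟨n, by simp [lcs, hn]⟩

variable (𝔤) in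
/-- The number of steps after which the lower central series vanishes. -/
def lcsLength : ℕ := (exists_lcs_eq_bot 𝔤).choose

theorem lcs_lcsLength : lcs 𝔤 (lcsLength 𝔤) = ⊥ := (exists_lcs_eq_bot 𝔤).choose_spec

theorem eq_of_forall_lcs {x y : 𝔤} (h : ∀ k, x - y ∈ lcs 𝔤 k → x - y ∈ lcs 𝔤 (k + 1)) : x = y := by
  have : ∀ k, x - y ∈ lcs 𝔤 k := fun k => by
    induction k with
    | zero => exact mem_lcs_zero _
    | succ k ih => exact h k ih
  have := this (lcsLength 𝔤)
  rw [lcs_lcsLength, Submodule.mem_bot] at this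
  exact sub_eq_zero.1 this

/-- Successive iterates differ by elements of deeper and deeper terms of the lower central series,
so the iteration is stationary after `lcsLength` steps: Banach's fixed point argument in a finite
filtration. -/
theorem Contracting.isFixedPt_iterate {T : 𝔤 → 𝔤} (hT : Contracting T) (x : 𝔤) :
    T (T^[lcsLength 𝔤] x) = T^[lcsLength 𝔤] x := by
  have : ∀ k, T^[k + 1] x - T^[k] x ∈ lcs 𝔤 k := fun k => by
    induction k with
    | zero => exact mem_lcs_zero _
    | succ k ih =>
      rw [Function.iterate_succ_apply' T (k + 1), Function.iterate_succ_apply' T k]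
      rw [Function.iterate_succ_apply' T k] at ih
      exact hT k _ _ ih
  have := this (lcsLength 𝔤)
  rw [lcs_lcsLength, Submodule.mem_bot, Function.iterate_succ_apply'] at this
  exact sub_eq_zero.1 this

theorem Contracting.add_bijective {S : 𝔤 → 𝔤} (hS : Contracting S) :
    Function.Bijective fun x => x + S x := by
  constructor
  · intro x y h
    refine eq_of_forall_lcs fun k hk => ?_
    have h' : x + S x = y + S y := h
    have : x - y = -(S x - S y) := by
      rw [sub_eq_iff_eq_add, neg_sub, sub_add_eq_add_sub, add_comm, ← h']; abel
    rw [this]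
    exact neg_mem (hS k x y hk)
  · intro y
    -- Solving `x + S x = y` means finding a fixed point of `x ↦ y - S x`.
    have h := (hS.neg.const_add y).isFixedPt_iterate 0
    refine ⟨(fun x => y + -S x)^[lcsLength 𝔤] 0, ?_⟩
    exact (eq_add_neg_iff_add_eq.1 h.symm)

/-- Difference quotients along `v` lie in the subspace `lcs 𝔤 (k + 1)`, which is closed. -/
theorem fderiv_mem_lcs {S : 𝔤 → 𝔤} (hS : Contracting S) {S' : 𝔤 →L[ℝ] 𝔤} {x : 𝔤}
    (h : HasFDerivAt S S' x) {k : ℕ} {v : 𝔤} (hv : v ∈ lcs 𝔤 k) : S' v ∈ lcs 𝔤 (k + 1) := by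
  have hl := h.hasLineDerivAt v
  have ht := hl.tendsto_slope_zero
  have hc : IsClosed (lcs 𝔤 (k + 1) : Set 𝔤) := Submodule.closed_of_finiteDimensional _
  refine hc.mem_of_tendsto ht (.of_forall fun t => ?_)
  refine Submodule.smul_mem _ _ (hS k _ _ ?_)
  simpa using Submodule.smul_mem _ t hv

/-- `-N` is nilpotent, so its characteristic polynomial is a power of `X`; its value at 1 is `det (1
+ N)`. -/
theorem det_id_add_eq_one {N : 𝔤 →L[ℝ] 𝔤}
    (h : ∀ k, ∀ v ∈ lcs 𝔤 k, N v ∈ lcs 𝔤 (k + 1)) :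
    (ContinuousLinearMap.id ℝ 𝔤 + N).det = 1 := by
  have hn : ∀ m : 𝔤, ∃ n : ℕ, ((-(N : 𝔤 →ₗ[ℝ] 𝔤)) ^ n) m = 0 := fun m => by
    refine ⟨lcsLength 𝔤, ?_⟩
    have : ∀ k, ((-(N : 𝔤 →ₗ[ℝ] 𝔤)) ^ k) m ∈ lcs 𝔤 k := fun k => by
      induction k with
      | zero => exact mem_lcs_zero _
      | succ k ih =>
        rw [pow_succ', Module.End.mul_apply, LinearMap.neg_apply]
        exact neg_mem (h k _ ih)
    have := this (lcsLength 𝔤)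
    rwa [lcs_lcsLength, Submodule.mem_bot] at this
  have h1 := (LinearMap.charpoly_eq_X_pow_iff (-(N : 𝔤 →ₗ[ℝ] 𝔤))).2 hn
  have h2 := LinearMap.eval_charpoly (-(N : 𝔤 →ₗ[ℝ] 𝔤)) 1
  rw [h1, Polynomial.eval_pow, Polynomial.eval_X, one_pow, map_one, sub_neg_eq_add] at h2
  exact h2.symm

variable (μ : Measure 𝔤) [μ.IsAddHaarMeasure]

/-- A triangular perturbation of the identity preserves Haar measure. -/
theorem Contracting.measurePreserving {S : 𝔤 → 𝔤} (hS : Contracting S)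
    (hd : Differentiable ℝ S) : MeasurePreserving (fun x => x + S x) μ μ := by
  have hm : Measurable fun x => x + S x := (continuous_id.add hd.continuous).measurable
  have hb := hS.add_bijective
  refine ⟨hm, Measure.ext fun s hs => ?_⟩
  rw [Measure.map_apply hm hs]
  have h := lintegral_abs_det_fderiv_eq_addHaar_image μ (hm hs)
    (f' := fun x => ContinuousLinearMap.id ℝ 𝔤 + fderiv ℝ S x)
    (fun x _ => ((hasFDerivAt_id x).add (hd x).hasFDerivAt).hasFDerivWithinAt) hb.1.injOn
  simp only [fun x => det_id_add_eq_one fun k v hv =>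
    fderiv_mem_lcs hS (hd x).hasFDerivAt (k := k) (v := v) hv] at h
  simp only [abs_one, ENNReal.ofReal_one, lintegral_one, Measure.restrict_apply_univ] at h
  exact h.trans (congrArg μ (Set.image_preimage_eq s hb.2))

end Nilpotent

/-! ### The Baker-Campbell-Hausdorff product is triangular of polynomial growth -/

/-- The nested bracket of a word in two letters. -/
def wordLie (w : List Bool) (X Y : 𝔤) : 𝔤 := nestedLie (w.map fun b => cond b X Y)

theorem wordLie_cons_cons (a b : Bool) (w : List Bool) (X Y : 𝔤) :
    wordLie (a :: b :: w) X Y = ⁅cond a X Y, wordLie (b :: w) X Y⁆ := rfl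

theorem wordLie_sub_mem {k : ℕ} {X X' Y Y' : 𝔤} (hX : X - X' ∈ lcs 𝔤 k) (hY : Y - Y' ∈ lcs 𝔤 k) :
    ∀ w : List Bool, wordLie w X Y - wordLie w X' Y' ∈ lcs 𝔤 k
  | [] => by simp [wordLie, nestedLie]
  | [a] => by cases a <;> simpa [wordLie, nestedLie]
  | a :: b :: w => by
    have ih := wordLie_sub_mem hX hY (b :: w)
    have ha : cond a X Y - cond a X' Y' ∈ lcs 𝔤 k := by cases a <;> simpa
    rw [wordLie_cons_cons, wordLie_cons_cons]
    have : ⁅cond a X Y, wordLie (b :: w) X Y⁆ - ⁅cond a X' Y', wordLie (b :: w) X' Y'⁆ =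
        ⁅cond a X Y - cond a X' Y', wordLie (b :: w) X Y⁆ +
          ⁅cond a X' Y', wordLie (b :: w) X Y - wordLie (b :: w) X' Y'⁆ := by
      rw [sub_lie, lie_sub]; abel
    rw [this]
    exact lcs_antitone (Nat.le_succ k)
      (add_mem (lie_mem_lcs_left _ ha) (lie_mem_lcs_right _ ih))

/-- A single letter gains nothing, but a word of length at least two carries an outer bracket, and
bracketing raises the filtration degree by one. -/
theorem contracting₂_wordLie {w : List Bool} (hw : 2 ≤ w.length) :
    Contracting₂ (wordLie (𝔤 := 𝔤) w) := by
  match w, hw with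
  | a :: b :: w, _ =>
    intro k X X' Y Y' hX hY
    have ih := wordLie_sub_mem hX hY (b :: w)
    have ha : cond a X Y - cond a X' Y' ∈ lcs 𝔤 k := by cases a <;> simpa
    rw [wordLie_cons_cons, wordLie_cons_cons]
    have : ⁅cond a X Y, wordLie (b :: w) X Y⁆ - ⁅cond a X' Y', wordLie (b :: w) X' Y'⁆ =
        ⁅cond a X Y - cond a X' Y', wordLie (b :: w) X Y⁆ +
          ⁅cond a X' Y', wordLie (b :: w) X Y - wordLie (b :: w) X' Y'⁆ := by
      rw [sub_lie, lie_sub]; abel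
    rw [this]
    exact add_mem (lie_mem_lcs_left _ ha) (lie_mem_lcs_right _ ih)

variable (𝔤) in
/-- The Lie bracket as a continuous bilinear map. -/
def bracketCLM : 𝔤 →L[ℝ] 𝔤 →L[ℝ] 𝔤 :=
  LinearMap.toContinuousBilinearMap
    (LinearMap.mk₂ ℝ (fun x y : 𝔤 => ⁅x, y⁆) add_lie smul_lie lie_add (fun c x y => lie_smul c x y))

theorem hasTemperateGrowth_fst {E F : Type*} [NormedAddCommGroup E] [NormedSpace ℝ E]
    [NormedAddCommGroup F] [NormedSpace ℝ F] :
    Function.HasTemperateGrowth fun q : E × F => q.1 :=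
  (ContinuousLinearMap.fst ℝ E F).hasTemperateGrowth

theorem hasTemperateGrowth_snd {E F : Type*} [NormedAddCommGroup E] [NormedSpace ℝ E]
    [NormedAddCommGroup F] [NormedSpace ℝ F] :
    Function.HasTemperateGrowth fun q : E × F => q.2 :=
  (ContinuousLinearMap.snd ℝ E F).hasTemperateGrowth

theorem hasTemperateGrowth_wordLie {D : Type*} [NormedAddCommGroup D] [NormedSpace ℝ D]
    {f g : D → 𝔤} (hf : f.HasTemperateGrowth) (hg : g.HasTemperateGrowth) :
    ∀ w : List Bool, Function.HasTemperateGrowth fun q : D => wordLie w (f q) (g q)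
  | [] => .const 0
  | [true] => hf
  | [false] => hg
  | a :: b :: w => by
    have ih := hasTemperateGrowth_wordLie hf hg (b :: w)
    have ha : Function.HasTemperateGrowth fun q : D => cond a (f q) (g q) := by
      cases a
      · exact hg
      · exact hf
    exact (bracketCLM 𝔤).bilinear_hasTemperateGrowth ha ih

theorem dynkinTerm_eq (n : ℕ) (p : Fin n → ℕ × ℕ) :
    ∃ (c : ℝ) (w : List Bool), w.length = ∑ i, ((p i).1 + (p i).2) ∧
      ∀ X Y : 𝔤, dynkinTerm X Y n p = c • wordLie w X Y := by
  refine ⟨(-1 : ℝ) ^ (n - 1) / (n : ℝ) * ((∑ i, ((p i).1 + (p i).2) : ℕ) : ℝ)⁻¹ *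
      ∏ i, (((p i).1.factorial : ℝ) * ((p i).2.factorial : ℝ))⁻¹, (List.ofFn fun i => List.replicate (p i).1 true ++
    List.replicate (p i).2 false).flatten, ?_, fun X Y => ?_⟩
  · simp [List.length_flatten, List.map_ofFn, List.sum_ofFn, Function.comp_def]
  · rw [dynkinTerm, wordLie]
    congr 2
    simp [List.map_flatten, List.map_ofFn, Function.comp_def]

theorem Contracting₂.sum {ι : Type*} {s : Finset ι} {R : ι → 𝔤 → 𝔤 → 𝔤}
    (h : ∀ i ∈ s, Contracting₂ (R i)) : Contracting₂ fun X Y => ∑ i ∈ s, R i X Y :=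
  fun k x x' y y' hx hy => by
    rw [← Finset.sum_sub_distrib]
    exact sum_mem fun i hi => h i hi k x x' y y' hx hy

theorem sum_dynkinTerm_one (X Y : 𝔤) :
    ∑ n ∈ Finset.Icc 1 1, ∑ p ∈ dynkinIndex 1 n, dynkinTerm X Y n p = X + Y := by
  have : dynkinIndex 1 1 = {fun _ => (1, 0), fun _ => (0, 1)} := by decide
  rw [Finset.Icc_self, Finset.sum_singleton, this, Finset.sum_pair (by decide)]
  simp [dynkinTerm, nestedLie]

/-- The part of degree at least two of the Baker-Campbell-Hausdorff product. -/
def bchRem (X Y : 𝔤) : 𝔤 := bch X Y - (X + Y)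

variable [LieRing.IsNilpotent 𝔤]

theorem bchRem_eq (X Y : 𝔤) :
    bchRem X Y = ∑ N ∈ Finset.Icc 2 (LieModule.nilpotencyLength 𝔤 𝔤), ∑ n ∈ Finset.Icc 1 N,
      ∑ p ∈ dynkinIndex N n, dynkinTerm X Y n p := by
  rcases Nat.eq_zero_or_pos (LieModule.nilpotencyLength 𝔤 𝔤) with h | h
  -- At nilpotency length 0 the sum `bch` is empty and lacks even the term `X + Y`, but then `𝔤` is
  -- trivial.
  · have := (LieModule.nilpotencyLength_eq_zero_iff 𝔤 𝔤).1 h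
    exact Subsingleton.elim _ _
  · rw [bchRem, bch, ← Finset.insert_Icc_add_one_left_eq_Icc h, Finset.sum_insert (by simp),
      sum_dynkinTerm_one, add_sub_cancel_left, one_add_one_eq_two]

theorem contracting₂_bchRem : Contracting₂ (bchRem (𝔤 := 𝔤)) := by
  have : bchRem (𝔤 := 𝔤) = fun X Y => ∑ N ∈ Finset.Icc 2 (LieModule.nilpotencyLength 𝔤 𝔤),
      ∑ n ∈ Finset.Icc 1 N, ∑ p ∈ dynkinIndex N n, dynkinTerm X Y n p := by
    funext X Y; exact bchRem_eq X Y
  rw [this]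
  refine Contracting₂.sum fun N hN => Contracting₂.sum fun n _ => Contracting₂.sum fun p hp => ?_
  obtain ⟨c, w, hw, h⟩ := dynkinTerm_eq (𝔤 := 𝔤) n p
  have hl : 2 ≤ w.length := by
    rw [hw, (Finset.mem_filter.1 hp).2.2]; exact (Finset.mem_Icc.1 hN).1
  intro k x x' y y' hx hy
  beta_reduce
  rw [h, h, ← smul_sub]
  exact Submodule.smul_mem _ _ (contracting₂_wordLie hl k x x' y y' hx hy)

theorem hasTemperateGrowth_bch {D : Type*} [NormedAddCommGroup D] [NormedSpace ℝ D]
    {f g : D → 𝔤} (hf : f.HasTemperateGrowth) (hg : g.HasTemperateGrowth) :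
    Function.HasTemperateGrowth fun q : D => bch (f q) (g q) := by
  unfold bch
  refine .sum fun N _ => .sum fun n _ => .sum fun p _ => ?_
  obtain ⟨c, w, -, h⟩ := dynkinTerm_eq (𝔤 := 𝔤) n p
  simp only [h]
  exact (Function.HasTemperateGrowth.const c).smul (hasTemperateGrowth_wordLie hf hg w)

/-! ### The division maps of the group -/

/-- The map `Y ↦ X • (-Y)`. -/
def sepMap (X Y : 𝔤) : 𝔤 := bch X (-Y)

/-- The inverse of `Y ↦ X • (-Y)`. -/
def sepInv (X W : 𝔤) : 𝔤 := (fun Y => (X - W) + bchRem X (-Y))^[lcsLength 𝔤] 0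

theorem contracting₂_bchRem_neg : Contracting₂ fun X Y : 𝔤 => bchRem X (-Y) :=
  fun k x x' y y' hx hy => contracting₂_bchRem k x x' (-y) (-y') hx
    (by rw [neg_sub_neg, ← neg_sub]; exact neg_mem hy)

theorem sepMap_def (X Y : 𝔤) : sepMap X Y = bch X (-Y) := rfl

/-- `X • (-Y) = W` is equivalent to `Y = (X - W) + bchRem X (-Y)`, a fixed point equation for a
contracting map. In the group the solution is `(-W) • X`, but associativity is not needed. -/
theorem sepInv_eq (X W : 𝔤) : sepInv X W = (X - W) + bchRem X (-sepInv X W) :=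
  (((contracting₂_bchRem_neg (𝔤 := 𝔤)).right X).const_add (X - W)).isFixedPt_iterate 0 |>.symm

theorem sepMap_eq (X Y : 𝔤) : sepMap X Y = -(Y + (-X + -bchRem X (-Y))) := by
  rw [bchRem, sepMap]; abel

theorem sepMap_sepInv (X W : 𝔤) : sepMap X (sepInv X W) = W := by
  rw [sepMap_eq]
  have h := sepInv_eq X W
  have h2 : bchRem X (-sepInv X W) = sepInv X W - (X - W) := eq_sub_of_add_eq' h.symm
  rw [h2]; abel

theorem contracting_sepMap (X : 𝔤) : Contracting fun Y : 𝔤 => -X + -bchRem X (-Y) :=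
  ((contracting₂_bchRem_neg (𝔤 := 𝔤)).right X).neg.const_add (-X)

theorem sepMap_injective (X : 𝔤) : Function.Injective (sepMap X) := by
  intro Y Y' h
  rw [sepMap_eq, sepMap_eq, neg_inj] at h
  exact (contracting_sepMap X).add_bijective.1 h

theorem sepInv_sepMap (X Y : 𝔤) : sepInv X (sepMap X Y) = Y :=
  sepMap_injective X (sepMap_sepInv X _)

section Regularity

variable {D : Type*} [NormedAddCommGroup D] [NormedSpace ℝ D] {f g : D → 𝔤}

theorem hasTemperateGrowth_sepMap (hf : f.HasTemperateGrowth) (hg : g.HasTemperateGrowth) :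
    Function.HasTemperateGrowth fun q : D => sepMap (f q) (g q) :=
  hasTemperateGrowth_bch hf hg.neg

theorem hasTemperateGrowth_bchRem (hf : f.HasTemperateGrowth) (hg : g.HasTemperateGrowth) :
    Function.HasTemperateGrowth fun q : D => bchRem (f q) (g q) :=
  (hasTemperateGrowth_bch hf hg).sub (hf.add hg)

/-- The inverse is a fixed finite number of iterations of maps of temperate growth. -/
theorem hasTemperateGrowth_sepInv (hf : f.HasTemperateGrowth) (hg : g.HasTemperateGrowth) :
    Function.HasTemperateGrowth fun q : D => sepInv (f q) (g q) := by
  have : ∀ j : ℕ, Function.HasTemperateGrowth fun q : D =>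
      (fun Y => (f q - g q) + bchRem (f q) (-Y))^[j] 0 := fun j => by
    induction j with
    | zero => exact .const 0
    | succ j ih =>
      simp only [Function.iterate_succ_apply']
      exact (hf.sub hg).add (hasTemperateGrowth_bchRem hf ih.neg)
  exact this _

end Regularity

theorem continuous_sepMap : Continuous fun q : 𝔤 × 𝔤 => sepMap q.1 q.2 :=
  (hasTemperateGrowth_sepMap hasTemperateGrowth_fst hasTemperateGrowth_snd).1.continuous

theorem continuous_sepInv : Continuous fun q : 𝔤 × 𝔤 => sepInv q.1 q.2 :=
  (hasTemperateGrowth_sepInv hasTemperateGrowth_fst hasTemperateGrowth_snd).1.continuous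

variable (μ : Measure 𝔤) [μ.IsAddHaarMeasure]

theorem measurePreserving_sepMap (X : 𝔤) : MeasurePreserving (sepMap X) μ μ := by
  have hd : Differentiable ℝ fun Y : 𝔤 => -X + -bchRem X (-Y) :=
    ((Function.HasTemperateGrowth.const (-X)).add (hasTemperateGrowth_bchRem
      (.const X) Function.HasTemperateGrowth.id'.neg).neg).1.differentiable (by simp)
  have h := (Measure.measurePreserving_neg μ).comp
    ((contracting_sepMap X).measurePreserving μ hd)
  have e : sepMap X = Neg.neg ∘ fun Y => Y + (-X + -bchRem X (-Y)) := by
    funext Y; exact sepMap_eq X Y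
  rwa [e]

theorem measurePreserving_sepInv_right (X : 𝔤) : MeasurePreserving (sepInv X) μ μ := by
  have h := measurePreserving_sepMap μ X
  have hm : Measurable (sepInv X) := (continuous_sepInv.comp (by fun_prop :
    Continuous fun W => (X, W))).measurable
  refine ⟨hm, ?_⟩
  conv_lhs => rw [← h.map_eq]
  rw [Measure.map_map hm h.measurable]
  have : sepInv X ∘ sepMap X = id := funext (sepInv_sepMap X)
  rw [this, Measure.map_id]

/-- Bootstrapping in the fixed point equation: a difference in `lcs 𝔤 j` gives one in `lcs 𝔤 (j +
1)`, until the step `k` of `X - X'` is reached. -/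
theorem sepInv_sub_mem (Z : 𝔤) {X X' : 𝔤} {k : ℕ} (h : X - X' ∈ lcs 𝔤 k) :
    sepInv X Z - sepInv X' Z ∈ lcs 𝔤 k := by
  have key : ∀ j ≤ k, sepInv X Z - sepInv X' Z ∈ lcs 𝔤 j := fun j => by
    induction j with
    | zero => exact fun _ => mem_lcs_zero _
    | succ j ih =>
      intro hj
      have h1 := contracting₂_bchRem_neg j X X' _ _ (lcs_antitone (Nat.le_of_succ_le hj) h)
        (ih (Nat.le_of_succ_le hj))
      rw [sepInv_eq X, sepInv_eq X', add_sub_add_comm, sub_sub_sub_cancel_right]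
      exact add_mem (lcs_antitone hj h) h1
  exact key k le_rfl

/-- This is the invariance of Haar measure under the translation `X ↦ (-Z) • X`, obtained from
triangularity in `X`. -/
theorem measurePreserving_sepInv_left (Z : 𝔤) : MeasurePreserving (fun X => sepInv X Z) μ μ := by
  have hS : Contracting fun X : 𝔤 => -Z + bchRem X (-sepInv X Z) :=
    Contracting.const_add (fun k x y h =>
      contracting₂_bchRem_neg k x y _ _ h (sepInv_sub_mem Z h)) _
  have hd : Differentiable ℝ fun X : 𝔤 => -Z + bchRem X (-sepInv X Z) :=
    ((Function.HasTemperateGrowth.const (-Z)).add (hasTemperateGrowth_bchRem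
      .id' (hasTemperateGrowth_sepInv .id' (.const Z)).neg)).1.differentiable (by simp)
  have h := hS.measurePreserving μ hd
  have e : (fun X => sepInv X Z) = fun X => X + (-Z + bchRem X (-sepInv X Z)) := by
    funext X
    rw [← add_assoc, ← sub_eq_add_neg]
    exact sepInv_eq X Z
  rwa [e]

/-- Schwartz functions are stable under `u ↦ (W ↦ u (sepInv X (-W)))`. -/
def schwartzSepInv (X : 𝔤) : 𝓢(𝔤, ℂ) →L[ℂ] 𝓢(𝔤, ℂ) :=
  SchwartzMap.compCLM ℂ (g := fun W => sepInv X (-W))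
    (hasTemperateGrowth_sepInv (.const X) Function.HasTemperateGrowth.id'.neg) (by
      -- Composition preserves Schwartz decay if `‖W‖` is bounded polynomially in `‖sepInv X (-W)‖`;
      -- this is the growth bound of the inverse map `sepMap X`.
      obtain ⟨k, C, hC⟩ := (hasTemperateGrowth_sepMap (𝔤 := 𝔤) (.const X) .id').2 0
      refine ⟨k, C, fun W => ?_⟩
      have := hC (sepInv X (-W))
      rwa [norm_iteratedFDeriv_zero, sepMap_sepInv, norm_neg] at this)

theorem schwartzSepInv_apply (X : 𝔤) (u : 𝓢(𝔤, ℂ)) (W : 𝔤) :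
    schwartzSepInv X u W = u (sepInv X (-W)) := rfl

attribute [irreducible] sepMap sepInv

end NilpotentWeyl

namespace NilpotentWeyl

open Complex

variable {𝔤 : Type*} [NormedAddCommGroup 𝔤] [NormedSpace ℝ 𝔤] [FiniteDimensional ℝ 𝔤]
  [MeasurableSpace 𝔤] [BorelSpace 𝔤] [RealLieStructure 𝔤] [LieRing.IsNilpotent 𝔤]

/-! ### Kernels of pseudo-differential operators -/

theorem integral_comp_measurePreserving {α β : Type*} [MeasurableSpace α] [MeasurableSpace β]
    {m : Measure α} {n : Measure β} {φ : α → β} (hφ : MeasurePreserving φ m n) {g : β → ℂ}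
    (hg : AEStronglyMeasurable g n) : ∫ x, g (φ x) ∂m = ∫ y, g y ∂n := by
  rw [← hφ.map_eq] at hg ⊢
  exact (integral_map hφ.aemeasurable hg).symm

/-- The homeomorphism `Y ↦ X • (-Y)`. -/
def sepHomeo (X : 𝔤) : 𝔤 ≃ₜ 𝔤 where
  toFun := sepMap X
  invFun := sepInv X
  left_inv := sepInv_sepMap X
  right_inv := sepMap_sepInv X
  continuous_toFun := (hasTemperateGrowth_sepMap (.const X) .id').1.continuous
  continuous_invFun := (hasTemperateGrowth_sepInv (.const X) .id').1.continuous

variable {μ : Measure 𝔤} [μ.IsAddHaarMeasure] {ν : Measure (StrongDual ℝ 𝔤)} [ν.IsAddHaarMeasure]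

theorem integral_sepMap (X : 𝔤) (g : 𝔤 → ℂ) :
    ∫ Y, g (sepMap X Y) ∂μ = ∫ W, g W ∂μ :=
  (measurePreserving_sepMap μ X).integral_comp (sepHomeo X).measurableEmbedding g

theorem measurePreserving_shear :
    MeasurePreserving (fun p : 𝔤 × 𝔤 => (p.1, sepMap p.1 p.2)) (μ.prod μ) (μ.prod μ) :=
  (MeasurePreserving.id μ).skew_product (g := sepMap) continuous_sepMap.measurable
    (.of_forall fun X => (measurePreserving_sepMap μ X).map_eq)

theorem measurePreserving_shearInv :
    MeasurePreserving (fun p : 𝔤 × 𝔤 => (p.1, sepInv p.1 p.2)) (μ.prod μ) (μ.prod μ) :=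
  (MeasurePreserving.id μ).skew_product (g := sepInv) continuous_sepInv.measurable
    (.of_forall fun X => (measurePreserving_sepInv_right μ X).map_eq)

/-- The integral kernel of the pseudo-differential operator with square integrable symbol `f`. -/
def kerOf (hν : IsDualHaar μ ν) (f : Lp ℂ 2 (μ.prod ν)) (p : 𝔤 × 𝔤) : ℂ :=
  (pftEquiv hν).symm f (p.1, sepMap p.1 p.2)

theorem memLp_kerOf (hν : IsDualHaar μ ν) (f : Lp ℂ 2 (μ.prod ν)) :
    MemLp (kerOf hν f) 2 (μ.prod μ) :=
  (Lp.memLp ((pftEquiv hν).symm f)).comp_measurePreserving measurePreserving_shear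

theorem inner_eq_integral_kerOf (hν : IsDualHaar μ ν) (h f : Lp ℂ 2 (μ.prod ν)) :
    inner ℂ h f = ∫ p, starRingEnd ℂ (kerOf hν h p) * kerOf hν f p ∂(μ.prod μ) := by
  rw [← (pftEquiv hν).symm.inner_map_map, inner_eq_integral]
  exact (integral_comp_measurePreserving measurePreserving_shear
    (integrable_conj_mul (Lp.memLp _) (Lp.memLp _)).1).symm

theorem exists_kerOf_ae_eq (hν : IsDualHaar μ ν) {k : 𝔤 × 𝔤 → ℂ} (hk : MemLp k 2 (μ.prod μ)) :
    ∃ f, kerOf hν f =ᵐ[μ.prod μ] k := by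
  have hK := hk.comp_measurePreserving (measurePreserving_shearInv (μ := μ))
  refine ⟨pftEquiv hν (hK.toLp _), ?_⟩
  filter_upwards [(measurePreserving_shear (μ := μ)).quasiMeasurePreserving.ae hK.coeFn_toLp]
    with p hp
  rw [kerOf, LinearIsometryEquiv.symm_apply_apply, hp]
  simp [sepInv_sepMap]

theorem integral_exp_sepMap (u : 𝔤 → ℂ) (X : 𝔤) (ξ : StrongDual ℝ 𝔤) :
    ∫ Y, exp (I * (ξ (bch X (-Y)) : ℂ)) * u Y ∂μ =
      ∫ W, exp (I * (ξ W : ℂ)) * u (sepInv X W) ∂μ := by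
  rw [← integral_sepMap X fun W => exp (I * (ξ W : ℂ)) * u (sepInv X W)]
  simp only [← sepMap_def, sepInv_sepMap]

theorem integral_exp_eq_conj_ft (u : 𝔤 → ℂ) (ξ : StrongDual ℝ 𝔤) :
    ∫ W, exp (I * (ξ W : ℂ)) * u W ∂μ = starRingEnd ℂ (ft μ (fun W => starRingEnd ℂ (u W)) ξ) := by
  rw [ft, ← integral_conj]
  congr 1
  ext W
  rw [map_mul, conj_conj, ← exp_conj]
  simp

/-- Formally this is Plancherel in the fibre over `X`, pairing the fibre of `f` with the transform
of `W ↦ u (sepInv X W)`. As `pftEquiv` is defined only on `L²` of the product, both sides are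
integrated over sets `s` of finite measure and compared there. -/
theorem isOp_of_hasKer (hν : IsDualHaar μ ν) {f : Lp ℂ 2 (μ.prod ν)}
    {T : Lp ℂ 2 μ →L[ℂ] Lp ℂ 2 μ} (hT : HasKer μ T (kerOf hν f)) : IsOp μ ν f T := by
  intro u
  set K := (pftEquiv hν).symm f with hK
  let V : 𝔤 × 𝔤 → ℂ := fun p => starRingEnd ℂ (u (sepInv p.1 p.2))
  have e1 : T (u.toLp 2 μ) =ᵐ[μ] fun X => ∫ W, starRingEnd ℂ (V (X, W)) * K (X, W) ∂μ := by
    filter_upwards [hT (u.toLp 2 μ)] with X hX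
    rw [hX, ← integral_sepMap X fun W => starRingEnd ℂ (V (X, W)) * K (X, W)]
    refine integral_congr_ae ?_
    filter_upwards [u.coeFn_toLp 2 μ] with Y hY
    simp only [hY, kerOf, V, conj_conj, sepInv_sepMap]
    rw [mul_comm]
  have e2 : opIntegral μ ν f u = fun X => ∫ ξ, starRingEnd ℂ (pft μ V (X, ξ)) * f (X, ξ) ∂ν := by
    funext X
    rw [opIntegral]
    congr 1
    ext ξ
    rw [integral_exp_sepMap, integral_exp_eq_conj_ft (fun W => u (sepInv X W)), mul_comm]
    rfl
  rw [e2]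
  refine e1.trans ?_
  have hVs : ∀ s : Set 𝔤, MeasurableSet s → μ s < ⊤ →
      MemLp (fun p : 𝔤 × 𝔤 => s.indicator (fun _ => (1 : ℂ)) p.1 * V p) 2 (μ.prod μ) :=
    fun s hs hms => (memLp_tensor (memLp_indicator_const 2 hs 1 (.inr hms.ne))
      (u.memLp 2 μ).star).comp_measurePreserving measurePreserving_shearInv
  have hVs1 : ∀ s : Set 𝔤, ∀ᵐ X ∂μ,
      Integrable (fun W => s.indicator (fun _ => (1 : ℂ)) X * V (X, W)) μ := fun s =>
    .of_forall fun X => by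
      have h1 : Integrable (fun W => star (u W)) μ := by
        have := (u.integrable (μ := μ))
        rw [← memLp_one_iff_integrable] at this ⊢
        exact this.star
      exact ((measurePreserving_sepInv_right μ X).integrable_comp_of_integrable h1).const_mul _
  have hp : ∀ s : Set 𝔤, pft μ (fun p : 𝔤 × 𝔤 => s.indicator (fun _ => (1 : ℂ)) p.1 * V p) =
      fun p => s.indicator (fun _ => (1 : ℂ)) p.1 * pft μ V p := fun s => by
    ext p
    exact ft_const_mul (μ := μ) (s.indicator (fun _ => (1 : ℂ)) p.1) (fun W => V (p.1, W)) p.2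
  have hA := fun s hs hms => integrableOn_fiber_inner (n := μ) hs (hVs s hs hms) (Lp.memLp K)
  have hB := fun s hs (hms : μ s < ⊤) => integrableOn_fiber_inner (n := ν) (f := pft μ V) hs
    (hp s ▸ memLp_pft hν (hVs s hs hms) (hVs1 s)) (Lp.memLp f)
  refine ae_eq_of_forall_integral_indicator (fun s hs hms => (hA s hs hms).1)
    (fun s hs hms => (hB s hs hms).1) fun s hs hms => ?_
  rw [(hA s hs hms).2, (hB s hs hms).2,
    ← integral_conj_pft_mul_pftEquiv hν (hVs s hs hms) (hVs1 s), hp, hK,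
    LinearIsometryEquiv.apply_symm_apply]

theorem IsOp.unique {F : Phase 𝔤 → ℂ} {T S : Lp ℂ 2 μ →L[ℂ] Lp ℂ 2 μ} (hT : IsOp μ ν F T)
    (hS : IsOp μ ν F S) : T = S := by
  have hd : DenseRange (SchwartzMap.toLpCLM ℂ (E := 𝔤) ℂ 2 μ) :=
    SchwartzMap.denseRange_toLpCLM ENNReal.ofNat_ne_top
  refine ContinuousLinearMap.coeFn_injective
    (hd.equalizer T.continuous S.continuous (funext fun u => ?_))
  exact Lp.ext ((hT u).trans (hS u).symm)

theorem IsOp.op_eq {F : Phase 𝔤 → ℂ} {T : Lp ℂ 2 μ →L[ℂ] Lp ℂ 2 μ} (hT : IsOp μ ν F T) :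
    Op μ ν F = T := by
  have h : ∃ T, IsOp μ ν F T := ⟨T, hT⟩
  rw [Op, dif_pos h]
  exact h.choose_spec.unique hT

theorem hasKer_op (hν : IsDualHaar μ ν) (f : Lp ℂ 2 (μ.prod ν)) :
    HasKer μ (Op μ ν f) (kerOf hν f) := by
  obtain ⟨T, hT⟩ := exists_hasKer (memLp_kerOf hν f)
  rwa [(isOp_of_hasKer hν hT).op_eq]

/-- Every square integrable kernel comes from a symbol, so `T` is in the range of `Op` and `symb` is
a genuine preimage; uniqueness of kernels does the rest. -/
theorem kerOf_symb (hν : IsDualHaar μ ν) {T : Lp ℂ 2 μ →L[ℂ] Lp ℂ 2 μ} {k : 𝔤 × 𝔤 → ℂ}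
    (hT : HasKer μ T k) (hk : MemLp k 2 (μ.prod μ)) :
    kerOf hν (symb μ ν T) =ᵐ[μ.prod μ] k := by
  obtain ⟨f, hf⟩ := exists_kerOf_ae_eq hν hk
  have h : ∃ f : Lp ℂ 2 (μ.prod ν), Op μ ν f = T := ⟨f, ((hasKer_op hν f).congr hf).op_ext hT⟩
  have h2 : Op μ ν (symb μ ν T) = T := Function.invFun_eq h
  have h3 := hasKer_op hν (symb μ ν T)
  rw [h2] at h3
  exact h3.ker_ext hT (memLp_kerOf hν _) hk

theorem kerOf_moyal (hν : IsDualHaar μ ν) (f g : Lp ℂ 2 (μ.prod ν)) :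
    kerOf hν (moyal μ ν f g) =ᵐ[μ.prod μ] kcomp μ (kerOf hν f) (kerOf hν g) :=
  kerOf_symb hν ((hasKer_op hν f).comp (hasKer_op hν g) (memLp_kerOf hν f) (memLp_kerOf hν g))
    (memLp_kcomp (memLp_kerOf hν f) (memLp_kerOf hν g))

theorem kerOf_moyalAdj (hν : IsDualHaar μ ν) (f : Lp ℂ 2 (μ.prod ν)) :
    kerOf hν (moyalAdj μ ν f) =ᵐ[μ.prod μ] kadj (kerOf hν f) :=
  kerOf_symb hν ((hasKer_op hν f).adjoint (memLp_kerOf hν f)) (memLp_kadj (memLp_kerOf hν f))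

/-! ### The operators `Op(ε_𝒵)` -/

/-- The character `x ↦ e^{i⟨x|ζ⟩}`. -/
def char (ζ : StrongDual ℝ 𝔤) (x : 𝔤) : ℂ := exp (I * (ζ x : ℂ))

theorem norm_char (ζ : StrongDual ℝ 𝔤) (x : 𝔤) : ‖char ζ x‖ = 1 := by
  rw [char, mul_comm, norm_exp_ofReal_mul_I]

theorem measurable_char (ζ : StrongDual ℝ 𝔤) : Measurable (char ζ) := by
  have : Continuous (char ζ) := by unfold char; fun_prop
  exact this.measurable

theorem conj_char (ζ : StrongDual ℝ 𝔤) (x : 𝔤) :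
    starRingEnd ℂ (char ζ x) = exp (-(I * (ζ x : ℂ))) := by
  rw [char, ← exp_conj]
  simp

/-- After `W ↦ -W` the inner integral is the Fourier transform of the Schwartz function `W ↦ u
(sepInv X (-W))`, and the factor `e^{-i⟨Z|ξ⟩}` makes the outer integral its inversion at `-Z`. -/
theorem isOp_eps (hν : IsDualHaar μ ν) (𝒵 : Phase 𝔤) {U : Lp ℂ 2 μ →L[ℂ] Lp ℂ 2 μ}
    (hU : IsWeighted μ U (char 𝒵.2) fun x => sepInv x 𝒵.1) : IsOp μ ν (eps 𝒵) U := by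
  intro u
  filter_upwards [hU (u.toLp 2 μ),
    (measurePreserving_sepInv_left μ 𝒵.1).quasiMeasurePreserving.ae (u.coeFn_toLp 2 μ)] with X h1 h2
  rw [h1, h2, opIntegral]
  have key := hν (schwartzSepInv X u) (-𝒵.1)
  rw [schwartzSepInv_apply, neg_neg] at key
  rw [← key, ← integral_const_mul]
  congr 1
  ext ξ
  rw [integral_exp_sepMap, ← integral_neg_eq_self, eps, char]
  simp only [schwartzSepInv_apply, map_neg]
  push_cast
  simp only [mul_neg, neg_neg, mul_assoc]

theorem isWeighted_op_eps (hν : IsDualHaar μ ν) (𝒵 : Phase 𝔤) :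
    IsWeighted μ (Op μ ν (eps 𝒵)) (char 𝒵.2) fun x => sepInv x 𝒵.1 := by
  obtain ⟨U, hU⟩ := exists_isWeighted (measurable_char 𝒵.2) (norm_char 𝒵.2)
    (measurePreserving_sepInv_left μ 𝒵.1)
  rwa [(isOp_eps hν 𝒵 hU).op_eq]

/-- The left translation of kernels that corresponds to multiplication by `Op(ε_𝒴)`. -/
def twist (𝒴 : Phase 𝔤) (k : 𝔤 × 𝔤 → ℂ) (p : 𝔤 × 𝔤) : ℂ :=
  char 𝒴.2 p.1 * k (sepInv p.1 𝒴.1, p.2)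

theorem memLp_twist (𝒴 : Phase 𝔤) {k : 𝔤 × 𝔤 → ℂ} (hk : MemLp k 2 (μ.prod μ)) :
    MemLp (twist 𝒴 k) 2 (μ.prod μ) :=
  memLp_left_twist (measurable_char 𝒴.2) (norm_char 𝒴.2) (measurePreserving_sepInv_left μ 𝒴.1) hk

theorem hasKer_op_comp_adjoint_eps (hν : IsDualHaar μ ν) (𝒵 : Phase 𝔤) (f : Lp ℂ 2 (μ.prod ν)) :
    HasKer μ (Op μ ν f ∘L ContinuousLinearMap.adjoint (Op μ ν (eps 𝒵)))
      (kadj (twist 𝒵 (kadj (kerOf hν f)))) := by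
  have hk := memLp_kerOf hν f
  have h1 := (hasKer_op hν f).comp_weighted_adjoint hk (isWeighted_op_eps hν 𝒵)
    (measurable_char _) (norm_char _) (measurePreserving_sepInv_left μ 𝒵.1)
  have e : (fun p : 𝔤 × 𝔤 => starRingEnd ℂ (char 𝒵.2 p.2) * kerOf hν f (p.1, sepInv p.2 𝒵.1)) =
      kadj (twist 𝒵 (kadj (kerOf hν f))) := by
    ext p
    simp [kadj, twist]
  rwa [e] at h1

theorem hasKer_eps_comp (hν : IsDualHaar μ ν) (𝒴 : Phase 𝔤) {T : Lp ℂ 2 μ →L[ℂ] Lp ℂ 2 μ} {k : 𝔤 × 𝔤 → ℂ}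
    (hT : HasKer μ T k) : HasKer μ (Op μ ν (eps 𝒴) ∘L T) (twist 𝒴 k) :=
  hT.weighted_comp (isWeighted_op_eps hν 𝒴) (measurePreserving_sepInv_left μ 𝒴.1)

theorem kerOf_theta (hν : IsDualHaar μ ν) (𝒴 𝒵 : Phase 𝔤) (f : Lp ℂ 2 (μ.prod ν)) :
    kerOf hν (theta μ ν 𝒴 𝒵 f) =ᵐ[μ.prod μ]
      twist 𝒴 (kadj (twist 𝒵 (kadj (kerOf hν f)))) :=
  kerOf_symb hν (hasKer_eps_comp hν 𝒴 (hasKer_op_comp_adjoint_eps hν 𝒵 f))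
    (memLp_twist 𝒴 (memLp_kadj (memLp_twist 𝒵 (memLp_kadj (memLp_kerOf hν f)))))

theorem twist_congr_ae (𝒴 : Phase 𝔤) {k l : 𝔤 × 𝔤 → ℂ} (h : k =ᵐ[μ.prod μ] l) :
    twist 𝒴 k =ᵐ[μ.prod μ] twist 𝒴 l := by
  filter_upwards [((measurePreserving_sepInv_left μ 𝒴.1).prod
    (MeasurePreserving.id μ)).quasiMeasurePreserving.ae h] with p hp
  simp only [twist]
  exact congrArg _ hp

theorem kadj_congr_ae {α : Type*} [MeasurableSpace α] {m : Measure α} [SFinite m]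
    {k l : α × α → ℂ} (h : k =ᵐ[m.prod m] l) : kadj k =ᵐ[m.prod m] kadj l := by
  filter_upwards [Measure.measurePreserving_swap.quasiMeasurePreserving.ae h] with p hp
  rw [kadj, kadj, hp]

/-- The coorbit map in terms of the kernels of the symbol and of the window. -/
theorem coorbitMap_eq (hν : IsDualHaar μ ν) {h f : Lp ℂ 2 (μ.prod ν)} {kh kf : 𝔤 × 𝔤 → ℂ}
    (hh : kerOf hν h =ᵐ[μ.prod μ] kh) (hf : kerOf hν f =ᵐ[μ.prod μ] kf) (𝒴 𝒵 : Phase 𝔤) :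
    coorbitMap μ ν h f 𝒴 𝒵 =
      ∫ p, starRingEnd ℂ (kh p) * twist 𝒴 (kadj (twist 𝒵 (kadj kf))) p ∂(μ.prod μ) := by
  rw [coorbitMap, inner_eq_integral_kerOf hν]
  refine integral_congr_ae ?_
  filter_upwards [hh, kerOf_theta hν 𝒴 𝒵 f, twist_congr_ae 𝒴
    (kadj_congr_ae (twist_congr_ae 𝒵 (kadj_congr_ae hf)))] with p h1 h2 h3
  rw [h1, h2, h3]

end NilpotentWeyl

namespace NilpotentWeyl

open Complex

/-! ### Hilbert-Schmidt scalar products of products of kernels -/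

section Trace

variable {α : Type*} [MeasurableSpace α] {m : Measure α} [SFinite m] {h k a b : α × α → ℂ}

theorem kadj_kcomp (h k : α × α → ℂ) : kadj (kcomp m h k) = kcomp m (kadj k) (kadj h) := by
  ext p
  simp only [kadj, kcomp, Prod.fst_swap, Prod.snd_swap, Prod.swap_prod_mk, ← integral_conj, map_mul]
  simp only [mul_comm]

theorem integral_kadj (h k : α × α → ℂ) :
    ∫ p, starRingEnd ℂ (kadj h p) * kadj k p ∂(m.prod m) =
      starRingEnd ℂ (∫ p, starRingEnd ℂ (h p) * k p ∂(m.prod m)) := by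
  rw [← integral_conj, ← integral_prod_swap]
  simp only [kadj, Prod.swap_swap, map_mul, conj_conj]

/-- The identity `⟨HK, A⟩ = ⟨K, H*A⟩`. With the last variable `z` frozen it is Fubini in the other
two. -/
theorem integral_conj_kcomp_left (hh : MemLp h 2 (m.prod m)) (hk : MemLp k 2 (m.prod m))
    (ha : MemLp a 2 (m.prod m)) :
    ∫ p, starRingEnd ℂ (kcomp m h k p) * a p ∂(m.prod m) =
      ∫ p, starRingEnd ℂ (k p) * kcomp m (kadj h) a p ∂(m.prod m) := by
  rw [integral_prod_symm _ (integrable_conj_mul (memLp_kcomp hh hk) ha),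
    integral_prod_symm _ (integrable_conj_mul hk (memLp_kcomp (memLp_kadj hh) ha))]
  refine integral_congr_ae ?_
  filter_upwards [memLp_ae_right (memLp_swap hk), memLp_ae_right (memLp_swap ha)] with z hkz haz
  have hi : Integrable (fun p : α × α =>
      starRingEnd ℂ (k (p.2, z)) * (starRingEnd ℂ (h p) * a (p.1, z))) (m.prod m) := by
    refine (hh.star.integrable_mul (memLp_tensor haz hkz.star)).congr (.of_forall fun p => ?_)
    simp only [Pi.mul_apply, Pi.star_apply, RCLike.star_def, Prod.swap_prod_mk]
    ring
  have e1 : ∀ x, starRingEnd ℂ (kcomp m h k (x, z)) * a (x, z) =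
      ∫ y, starRingEnd ℂ (k (y, z)) * (starRingEnd ℂ (h (x, y)) * a (x, z)) ∂m := fun x => by
    rw [kcomp, ← integral_conj, ← integral_mul_const]
    congr 1; ext y
    rw [map_mul]; ring
  have e2 : ∀ y, starRingEnd ℂ (k (y, z)) * kcomp m (kadj h) a (y, z) =
      ∫ x, starRingEnd ℂ (k (y, z)) * (starRingEnd ℂ (h (x, y)) * a (x, z)) ∂m := fun y => by
    rw [kcomp, ← integral_const_mul]
    rfl
  simp only [e1, e2]
  exact integral_integral_swap hi

/-- The mirror image `⟨KB, A⟩ = ⟨K, AB*⟩`, obtained by taking adjoints throughout. -/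
theorem integral_conj_kcomp_right (hk : MemLp k 2 (m.prod m)) (hb : MemLp b 2 (m.prod m))
    (ha : MemLp a 2 (m.prod m)) :
    ∫ p, starRingEnd ℂ (kcomp m k b p) * a p ∂(m.prod m) =
      ∫ p, starRingEnd ℂ (k p) * kcomp m a (kadj b) p ∂(m.prod m) := by
  have h1 := integral_conj_kcomp_left (memLp_kadj hb) (memLp_kadj hk) (memLp_kadj ha)
  rw [← kadj_kcomp, integral_kadj, ← kadj_kcomp, integral_kadj] at h1
  exact (starRingEnd ℂ).injective h1

/-- Inherited from associativity of operator composition, through uniqueness of kernels. -/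
theorem kcomp_assoc_ae [MeasurableSpace.CountablyGenerated α] (hh : MemLp h 2 (m.prod m))
    (hk : MemLp k 2 (m.prod m)) (hb : MemLp b 2 (m.prod m)) :
    kcomp m (kcomp m h k) b =ᵐ[m.prod m] kcomp m h (kcomp m k b) := by
  obtain ⟨H, hH⟩ := exists_hasKer hh
  obtain ⟨K, hK⟩ := exists_hasKer hk
  obtain ⟨B, hB⟩ := exists_hasKer hb
  have h1 := (hH.comp hK hh hk).comp hB (memLp_kcomp hh hk) hb
  have h2 := hH.comp (hK.comp hB hk hb) hh (memLp_kcomp hk hb)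
  rw [ContinuousLinearMap.comp_assoc] at h1
  exact h1.ker_ext h2 (memLp_kcomp (memLp_kcomp hh hk) hb) (memLp_kcomp hh (memLp_kcomp hk hb))

/-- Cyclicity of the trace in Hilbert-Schmidt form: both sides are the pairing of `HKB` with `A`,
bracketed as `H(KB)` or `(HK)B`. -/
theorem integral_conj_kcomp_kcomp [MeasurableSpace.CountablyGenerated α]
    (hh : MemLp h 2 (m.prod m)) (hk : MemLp k 2 (m.prod m)) (ha : MemLp a 2 (m.prod m))
    (hb : MemLp b 2 (m.prod m)) :
    ∫ p, starRingEnd ℂ (kcomp m k b p) * kcomp m (kadj h) a p ∂(m.prod m) =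
      ∫ p, starRingEnd ℂ (kcomp m h k p) * kcomp m a (kadj b) p ∂(m.prod m) := by
  rw [← integral_conj_kcomp_left hh (memLp_kcomp hk hb) ha,
    ← integral_conj_kcomp_right (memLp_kcomp hh hk) hb ha]
  refine integral_congr_ae ?_
  filter_upwards [kcomp_assoc_ae hh hk hb] with p hp
  rw [hp]

end Trace

variable {𝔤 : Type*} [NormedAddCommGroup 𝔤] [NormedSpace ℝ 𝔤] [FiniteDimensional ℝ 𝔤]
  [MeasurableSpace 𝔤] [BorelSpace 𝔤] [RealLieStructure 𝔤] [LieRing.IsNilpotent 𝔤]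
  {μ : Measure 𝔤} [μ.IsAddHaarMeasure] {ν : Measure (StrongDual ℝ 𝔤)} [ν.IsAddHaarMeasure]

/-! ### Orthogonality relations -/

/-- The function whose partial Fourier transform is `𝒵 ↦ ⟨A Op(ε_𝒵)*, H⟩`, for operators `H`
and `A` with kernels `h` and `a`. -/
def correlation (μ : Measure 𝔤) (h a : 𝔤 × 𝔤 → ℂ) (p : 𝔤 × 𝔤) : ℂ :=
  kcomp μ (kadj h) a (p.2, sepInv p.2 p.1)

theorem measurePreserving_swap_shearInv :
    MeasurePreserving (fun p : 𝔤 × 𝔤 => (p.2, sepInv p.2 p.1)) (μ.prod μ) (μ.prod μ) :=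
  measurePreserving_shearInv.comp Measure.measurePreserving_swap

theorem memLp_correlation {h a : 𝔤 × 𝔤 → ℂ} (hh : MemLp h 2 (μ.prod μ))
    (ha : MemLp a 2 (μ.prod μ)) : MemLp (correlation μ h a) 2 (μ.prod μ) :=
  (memLp_kcomp (memLp_kadj hh) ha).comp_measurePreserving measurePreserving_swap_shearInv

/-- Cauchy-Schwarz with `Z` fixed. It holds for every `Z`, which makes `pft_correlation` an identity
at every point of `Ξ`. -/
theorem integrable_correlation_integrand {h a : 𝔤 × 𝔤 → ℂ} (hh : MemLp h 2 (μ.prod μ))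
    (ha : MemLp a 2 (μ.prod μ)) (Z : 𝔤) :
    Integrable (fun p : 𝔤 × 𝔤 => starRingEnd ℂ (h p) * a (p.1, sepInv p.2 Z)) (μ.prod μ) :=
  integrable_conj_mul hh (ha.comp_measurePreserving
    ((MeasurePreserving.id μ).prod (measurePreserving_sepInv_left μ Z)))

theorem integrable_correlation {h a : 𝔤 × 𝔤 → ℂ} (hh : MemLp h 2 (μ.prod μ))
    (ha : MemLp a 2 (μ.prod μ)) (Z : 𝔤) : Integrable (fun y => correlation μ h a (Z, y)) μ :=
  (integrable_correlation_integrand hh ha Z).integral_prod_right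

/-- The scalar product is `∫∫ conj h(x,y) e^{-i⟨y|ζ⟩} a(x, sepInv y Z) dx dy`. Integrating over `x`
first leaves the kernel of `H*A` at `(y, sepInv y Z)`, and the integral over `y` is a Fourier
transform at `ζ`. -/
theorem pft_correlation {h a : 𝔤 × 𝔤 → ℂ} (hh : MemLp h 2 (μ.prod μ))
    (ha : MemLp a 2 (μ.prod μ)) (𝒵 : Phase 𝔤) :
    pft μ (correlation μ h a) 𝒵 =
      ∫ p, starRingEnd ℂ (h p) * kadj (twist 𝒵 (kadj a)) p ∂(μ.prod μ) := by
  have hM : MemLp (kadj (twist 𝒵 (kadj a))) 2 (μ.prod μ) :=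
    memLp_kadj (memLp_twist 𝒵 (memLp_kadj ha))
  rw [integral_prod_symm _ (integrable_conj_mul hh hM)]
  refine integral_congr_ae (.of_forall fun y => ?_)
  simp only [correlation, kcomp, ← integral_const_mul]
  congr 1; ext x
  rw [← conj_char]
  simp only [kadj, twist, Prod.swap_prod_mk, map_mul, conj_conj]
  ring

theorem integral_conj_correlation_mul {h a h' a' : 𝔤 × 𝔤 → ℂ} (hh : MemLp h 2 (μ.prod μ))
    (ha : MemLp a 2 (μ.prod μ)) (hh' : MemLp h' 2 (μ.prod μ)) (ha' : MemLp a' 2 (μ.prod μ)) :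
    ∫ p, starRingEnd ℂ (correlation μ h a p) * correlation μ h' a' p ∂(μ.prod μ) =
      ∫ p, starRingEnd ℂ (kcomp μ (kadj h) a p) * kcomp μ (kadj h') a' p ∂(μ.prod μ) :=
  integral_comp_measurePreserving measurePreserving_swap_shearInv
    (integrable_conj_mul (memLp_kcomp (memLp_kadj hh) ha) (memLp_kcomp (memLp_kadj hh') ha')).1

theorem twist_kcomp (𝒴 : Phase 𝔤) (k l : 𝔤 × 𝔤 → ℂ) :
    twist 𝒴 (kcomp μ k l) = kcomp μ (twist 𝒴 k) l := by
  ext p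
  simp only [twist, kcomp, ← integral_const_mul, mul_assoc]

theorem twist_kadj_twist_kadj (𝒴 𝒵 : Phase 𝔤) (k : 𝔤 × 𝔤 → ℂ) :
    twist 𝒴 (kadj (twist 𝒵 (kadj k))) = kadj (twist 𝒵 (kadj (twist 𝒴 k))) := by
  ext p
  simp only [twist, kadj, Prod.fst_swap, Prod.snd_swap, Prod.swap_prod_mk, map_mul, conj_conj]
  ring

theorem coorbitMap_eq_pft (hν : IsDualHaar μ ν) (h f : Lp ℂ 2 (μ.prod ν)) (𝒴 𝒵 : Phase 𝔤) :
    coorbitMap μ ν h f 𝒴 𝒵 =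
      pft μ (correlation μ (kerOf hν h) (twist 𝒴 (kerOf hν f))) 𝒵 := by
  rw [coorbitMap_eq hν (ae_eq_refl _) (ae_eq_refl _),
    pft_correlation (memLp_kerOf hν h) (memLp_twist 𝒴 (memLp_kerOf hν f)), twist_kadj_twist_kadj]

/-- Taking adjoints exchanges the roles of `𝒴` and `𝒵`, so that the map becomes a partial Fourier
transform in its first point as well. -/
theorem coorbitMap_eq_conj_pft (hν : IsDualHaar μ ν) (h f : Lp ℂ 2 (μ.prod ν)) (𝒴 𝒵 : Phase 𝔤) :
    coorbitMap μ ν h f 𝒴 𝒵 = starRingEnd ℂ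
      (pft μ (correlation μ (kadj (kerOf hν h)) (twist 𝒵 (kadj (kerOf hν f)))) 𝒴) := by
  rw [coorbitMap_eq hν (ae_eq_refl _) (ae_eq_refl _),
    pft_correlation (memLp_kadj (memLp_kerOf hν h))
      (memLp_twist 𝒵 (memLp_kadj (memLp_kerOf hν f))), integral_kadj, conj_conj]

theorem coorbitMap_moyalAdj (hν : IsDualHaar μ ν) (h f : Lp ℂ 2 (μ.prod ν)) :
    coorbitMap μ ν (moyalAdj μ ν h) (moyalAdj μ ν f) = kerAdj (coorbitMap μ ν h f) := by
  funext 𝒴 𝒵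
  rw [kerAdj, coorbitMap_eq hν (kerOf_moyalAdj hν h) (kerOf_moyalAdj hν f), kadj_kadj,
    coorbitMap_eq hν (ae_eq_refl _) (ae_eq_refl _), ← integral_kadj, twist_kadj_twist_kadj,
    kadj_kadj]

theorem integrable_coorbitMap_mul (hν : IsDualHaar μ ν) (h k f g : Lp ℂ 2 (μ.prod ν))
    (𝒴 𝒵 : Phase 𝔤) :
    Integrable (fun 𝒳 => coorbitMap μ ν h f 𝒴 𝒳 * coorbitMap μ ν k g 𝒳 𝒵) (μ.prod ν) ∧
    ∫ 𝒳, coorbitMap μ ν h f 𝒴 𝒳 * coorbitMap μ ν k g 𝒳 𝒵 ∂(μ.prod ν) =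
      coorbitMap μ ν (moyal μ ν h k) (moyal μ ν f g) 𝒴 𝒵 := by
  have mh := memLp_kerOf hν h
  have mk := memLp_kerOf hν k
  have ma := memLp_twist 𝒴 (memLp_kerOf hν f)
  have mb := memLp_twist 𝒵 (memLp_kadj (memLp_kerOf hν g))
  have hV1 := memLp_correlation mh ma
  have hV2 := memLp_correlation (memLp_kadj mk) mb
  have hI1 : ∀ᵐ X ∂μ, _ := .of_forall (integrable_correlation mh ma)
  have hI2 : ∀ᵐ X ∂μ, _ := .of_forall (integrable_correlation (memLp_kadj mk) mb)
  have e : ∀ 𝒳, coorbitMap μ ν h f 𝒴 𝒳 * coorbitMap μ ν k g 𝒳 𝒵 = starRingEnd ℂ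
      (pft μ (correlation μ (kadj (kerOf hν k)) (twist 𝒵 (kadj (kerOf hν g)))) 𝒳) *
      pft μ (correlation μ (kerOf hν h) (twist 𝒴 (kerOf hν f))) 𝒳 := fun 𝒳 => by
    rw [coorbitMap_eq_pft hν h, coorbitMap_eq_conj_pft hν k, mul_comm]
  simp only [e]
  refine ⟨integrable_conj_mul (memLp_pft hν hV2 hI2) (memLp_pft hν hV1 hI1), ?_⟩
  -- Plancherel removes the Fourier transforms, the change of variables yields `⟨Op(h)*A, Op(k)B⟩`
  -- with `A = Op(ε_𝒴)Op(f)` and `B = Op(ε_𝒵)Op(g)*`, and cyclicity turns this into `⟨AB*,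
  -- Op(h)Op(k)⟩`.
  rw [integral_conj_pft_mul hν hV2 hI2 hV1 hI1,
    integral_conj_correlation_mul (memLp_kadj mk) mb mh ma, kadj_kadj,
    integral_conj_kcomp_kcomp mh mk ma mb,
    coorbitMap_eq hν (kerOf_moyal hν h k) (kerOf_moyal hν f g), kadj_kcomp, twist_kcomp,
    kadj_kcomp, kadj_kadj, twist_kcomp]

end NilpotentWeyl

end

theorem proposition6p7 {𝔤 : Type*} [NormedAddCommGroup 𝔤] [NormedSpace ℝ 𝔤]
    [FiniteDimensional ℝ 𝔤] [MeasurableSpace 𝔤] [BorelSpace 𝔤]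
    [RealLieStructure 𝔤] [LieRing.IsNilpotent 𝔤]
    (μ : Measure 𝔤) [μ.IsAddHaarMeasure]
    (ν : Measure (StrongDual ℝ 𝔤)) [ν.IsAddHaarMeasure]
    (hν : NilpotentWeyl.IsDualHaar μ ν)
    (h k : 𝓢(NilpotentWeyl.Phase 𝔤, ℂ)) (f g : Lp ℂ 2 (μ.prod ν)) :
    (∀ 𝒴 𝒵 : NilpotentWeyl.Phase 𝔤,
      Integrable (fun 𝒳 : NilpotentWeyl.Phase 𝔤 =>
        NilpotentWeyl.coorbitMap μ ν (h.toLp 2 (μ.prod ν)) f 𝒴 𝒳 *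
          NilpotentWeyl.coorbitMap μ ν (k.toLp 2 (μ.prod ν)) g 𝒳 𝒵) (μ.prod ν)) ∧
    NilpotentWeyl.coorbitMap μ ν
        (NilpotentWeyl.moyal μ ν (h.toLp 2 (μ.prod ν)) (k.toLp 2 (μ.prod ν)))
        (NilpotentWeyl.moyal μ ν f g) =
      NilpotentWeyl.kerComp μ ν
        (NilpotentWeyl.coorbitMap μ ν (h.toLp 2 (μ.prod ν)) f)
        (NilpotentWeyl.coorbitMap μ ν (k.toLp 2 (μ.prod ν)) g) ∧
    NilpotentWeyl.coorbitMap μ ν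
        (NilpotentWeyl.moyalAdj μ ν (h.toLp 2 (μ.prod ν))) (NilpotentWeyl.moyalAdj μ ν f) =
      NilpotentWeyl.kerAdj (NilpotentWeyl.coorbitMap μ ν (h.toLp 2 (μ.prod ν)) f) := by
  refine ⟨fun 𝒴 𝒵 => (NilpotentWeyl.integrable_coorbitMap_mul hν _ _ f g 𝒴 𝒵).1, ?_,
    NilpotentWeyl.coorbitMap_moyalAdj hν _ f⟩
  funext 𝒴 𝒵
  exact (NilpotentWeyl.integrable_coorbitMap_mul hν _ _ f g 𝒴 𝒵).2.symm
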